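/- Consider an $s$-stage Runge–Kutta method ($s\ge 1$) with real coefficient matrix $A\in\mathbb R^{s\times s}$ and weights $\mathbf b\in\mathbb R^s$. Put $\mathbb 1=(1,\dots,1)^T$, $\mathbf q(z)=\mathbf b^T(I-zA)^{-1}$ and $r(z)=1+z\mathbf b^T(I-zA)^{-1}\mathbb 1$. Assume that $A$ is invertible, that the last row of $A$ equals $\mathbf b^T$, and that the method is $A$-stable: for all $z\in\mathbb C$ with $\operatorname{Re}z\le 0$ the matrix $I-zA$ is invertible and $|r(z)|\le 1$. Let $$\boldsymbol\Delta(\zeta)=\Bigl(A+\tfrac{\zeta}{1-\zeta}\mathbb 1\mathbf b^T\Bigr)^{-1},\qquad (\boldsymbol\Delta(\zeta)-zI)^{-1}=\sum_{n\ge 0}\mathbf E_n(z)\zeta^n ,$$ and let $\mathbf e_n(z)$ be the last row of $\mathbf E_n(z)$. Fix a norm on $\mathbb C^s$ and a norm on $\mathbb C^{s\times s}$, both written $\|\cdot\|$. (i) There exist constants $\gamma>1$, $b>0$, $C_{\mathbf q}>0$ such that $$|r(z)|\le e^{\gamma\operatorname{Re}z}\ \text{ for } 0\le\operatorname{Re}z\le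 b,\qquad \|\mathbf q(z)\|\le C_{\mathbf q}\ \text{ for }\operatorname{Re}z\le b. \tag{1}$$ (ii) There exist constants $c>0$, $x_0>0$ such that $$\max\{\|\mathbf e_n(z)\|,\|\mathbf E_n(z)\|\}\le |x_0-c\operatorname{Re}z|^{-n-1}\quad\text{for all } n\ge 0 \text{ and all } z \text{ with } \operatorname{Re}z<0. \tag{2}$$ (iii) Let $\gamma,b,C_{\mathbf q}$ be any constants as in (1) and $c,x_0$ any constants as in (2). Let $0<\alpha<1$, $h>0$, $B>0$, $L_0>0$, and $L_j=(B+1)L_{j-1}$ for $1\le j\le J$. For $n\ge 0$, $1\le j\le J$ and $Q\ge 1$ let $\boldsymbol\tau_{n,j}(Q)$ be the error (integral minus quadrature rule) of $Q$-point Gauss–Legendre quadrature on $[L_{j-1},L_j]$ for $$\frac{h\sin(\pi\alpha)}{\pi}\int_{L_{j-1}}^{L_j}x^{-\alpha}\,\mathbf e_n(-hx)\,dx .$$ Then $$\|\boldsymbol\tau_{n,j}(Q)\|\le\frac{4hBL_{j-1}^{1-\alpha}\sin(\pi\alpha)}{\pi}\,\min_{0<\varepsilon<1}\frac{g(\varepsilon,B)^{-2Q+1}}{g(\varepsilon,B)}\,\varepsilon^{-\alpha}\min\bigl(C_{\mathbf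 q},|x_0+cL_{j-1}h\varepsilon|^{-n-1}\bigr),$$ where the minimum over $\varepsilon$ is attained and $$g(\varepsilon,B)=1+\tfrac2B(1-\varepsilon)+\sqrt{\bigl(1+\tfrac2B(1-\varepsilon)\bigr)^2-1}.$$ -/

import Mathlib

open scoped Matrix Polynomial PowerSeries

noncomputable section

namespace CQ

/-- The Legendre polynomial of degree `Q`, by Rodrigues' formula. -/
def legendre (Q : ℕ) : ℝ[X] :=
  Polynomial.C (1 / (2 ^ Q * (Q.factorial : ℝ))) *
    (Polynomial.derivative^[Q] ((Polynomial.X ^ 2 - 1) ^ Q))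

/-- The nodes of the `Q`-point Gauss-Legendre rule on `[-1, 1]`: the zeros of the Legendre
polynomial of degree `Q`. -/
def gaussNodes (Q : ℕ) : Finset ℝ := (legendre Q).roots.toFinset

/-- The weight belonging to the node `y`: the integral over `[-1, 1]` of the Lagrange basis
polynomial of `y`. -/
def gaussWeight (Q : ℕ) (y : ℝ) : ℝ :=
  ∫ x in (-1 : ℝ)..1, (Lagrange.basis (gaussNodes Q) id y).eval x

/-- The `Q`-point Gauss-Legendre rule, transplanted affinely from `[-1, 1]` to `[a, b]`. -/
def gaussRule {E : Type*} [AddCommGroup E] [Module ℝ E] (Q : ℕ) (a b : ℝ) (f : ℝ → E) : E :=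
  ((b - a) / 2) • ∑ y ∈ gaussNodes Q, gaussWeight Q y • f (a + (b - a) / 2 * (y + 1))

/-- The error (integral minus rule) of `Q`-point Gauss-Legendre quadrature on `[a, b]`. -/
def gaussError {E : Type*} [NormedAddCommGroup E] [NormedSpace ℝ E]
    (Q : ℕ) (a b : ℝ) (f : ℝ → E) : E :=
  (∫ x in a..b, f x) - gaussRule Q a b f

/-- The coefficient matrix and the weights of a Runge-Kutta method with `m + 1` stages. (The
abscissae do not enter the convolution quadrature weights.) -/
structure RungeKutta (m : ℕ) where
  A : Matrix (Fin (m + 1)) (Fin (m + 1)) ℝ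
  b : Fin (m + 1) → ℝ

namespace RungeKutta

variable {m : ℕ} (M : RungeKutta m)

/-- The coefficient matrix with complex entries. -/
def Ac : Matrix (Fin (m + 1)) (Fin (m + 1)) ℂ := M.A.map (fun x : ℝ => (x : ℂ))

/-- The weights as complex numbers. -/
def bc : Fin (m + 1) → ℂ := fun i => (M.b i : ℂ)

/-- The row vector `q(z) = bᵀ (I - z A)⁻¹`. -/
def q (z : ℂ) : Fin (m + 1) → ℂ := M.bc ᵥ* (1 - z • M.Ac)⁻¹

/-- The stability function `r(z) = 1 + z bᵀ (I - z A)⁻¹ 𝟙`. -/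
def r (z : ℂ) : ℂ := 1 + z * (M.bc ⬝ᵥ ((1 - z • M.Ac)⁻¹ *ᵥ 1))

/-- `A`-stability: for `Re z ≤ 0` the stage equations are uniquely solvable and `|r(z)| ≤ 1`. -/
def AStable : Prop :=
  ∀ z : ℂ, z.re ≤ 0 → (1 - z • M.Ac).det ≠ 0 ∧ ‖M.r z‖ ≤ 1

/-- The last row of the coefficient matrix is the vector of weights. -/
def StifflyAccurate : Prop := ∀ j, M.A (Fin.last m) j = M.b j

/-- The symbol `Δ(ζ) = (A + ζ / (1 - ζ) 𝟙 bᵀ)⁻¹`, a matrix of power series in `ζ`. -/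
def symbol : Matrix (Fin (m + 1)) (Fin (m + 1)) ℂ⟦X⟧ :=
  (M.Ac.map (PowerSeries.C (R := ℂ)) +
    ((PowerSeries.X : ℂ⟦X⟧) * (1 - PowerSeries.X)⁻¹) •
      (Matrix.vecMulVec 1 M.bc).map (PowerSeries.C (R := ℂ)))⁻¹

/-- `Eₙ(z)`, the coefficient of `ζⁿ` in `(Δ(ζ) - z I)⁻¹`. -/
def E (n : ℕ) (z : ℂ) : Matrix (Fin (m + 1)) (Fin (m + 1)) ℂ :=
  ((M.symbol - (PowerSeries.C z : ℂ⟦X⟧) • 1)⁻¹).map (PowerSeries.coeff n)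

/-- `eₙ(z)`, the last row of `Eₙ(z)`. -/
def e (n : ℕ) (z : ℂ) : Fin (m + 1) → ℂ := M.E n z (Fin.last m)

/-- The integrand `h sin(πα) / π · x^(-α) eₙ(-h x)` of the `n`-th convolution weight. -/
def integrand (α h : ℝ) (n : ℕ) (x : ℝ) : Fin (m + 1) → ℂ :=
  (h * Real.sin (Real.pi * α) / Real.pi * x ^ (-α)) • M.e n (-(h * x : ℝ))

/-- Admissible constants `γ, β, Cq`: `|r(z)| ≤ e^(γ Re z)` for `0 ≤ Re z ≤ β` and
`‖q(z)‖ ≤ Cq` for `Re z ≤ β`. -/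
def IsStabilityBound (N : Seminorm ℂ (Fin (m + 1) → ℂ)) (γ β Cq : ℝ) : Prop :=
  1 < γ ∧ 0 < β ∧ 0 < Cq ∧
    (∀ z : ℂ, 0 ≤ z.re → z.re ≤ β → ‖M.r z‖ ≤ Real.exp (γ * z.re)) ∧
    (∀ z : ℂ, z.re ≤ β → N (M.q z) ≤ Cq)

/-- Admissible constants `c, x₀`:
`max {‖eₙ(z)‖, ‖Eₙ(z)‖} ≤ |x₀ - c Re z|^(-n-1)` for all `n` and all `z` with `Re z < 0`. -/
def IsDecayBound (N : Seminorm ℂ (Fin (m + 1) → ℂ))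
    (N' : Seminorm ℂ (Matrix (Fin (m + 1)) (Fin (m + 1)) ℂ)) (c x₀ : ℝ) : Prop :=
  0 < c ∧ 0 < x₀ ∧
    ∀ (n : ℕ) (z : ℂ), z.re < 0 →
      max (N (M.e n z)) (N' (M.E n z)) ≤ |x₀ - c * z.re| ^ (-(n : ℤ) - 1)

end RungeKutta

/-- `g(ε, B) = 1 + (2/B)(1 - ε) + √((1 + (2/B)(1 - ε))² - 1)`. -/
def g (ε B : ℝ) : ℝ :=
  1 + 2 / B * (1 - ε) + Real.sqrt ((1 + 2 / B * (1 - ε)) ^ 2 - 1)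

/-- The function of `ε` that is minimized in the error bound; `ℓ` is the left end point of the
interval of integration. -/
def boundFun (α h B ℓ Cq c x₀ : ℝ) (n Q : ℕ) (ε : ℝ) : ℝ :=
  g ε B ^ (-2 * (Q : ℤ) + 1) / g ε B * ε ^ (-α) *
    min Cq (|x₀ + c * ℓ * h * ε| ^ (-(n : ℤ) - 1))

end CQ

end

namespace CQ

open Polynomial

/-! ### Gauss-Legendre quadrature -/

/-! With `R = (I - zA)⁻¹`, the Sherman-Morrison formula gives `(Δ(ζ) - zI)⁻¹ = A R + ζ (1 - rζ)⁻¹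
(R𝟙) q` (`symbol_resolvent`). Stiff accuracy makes `r` the last entry of `R𝟙` and `q` the last row
of `A R`, so `eₙ = rⁿ q` (`e_eq`). The poles of `R` are finitely many and lie in the open right
half-plane, and `A` is invertible, so the entries of `R` are `O(1 / (1 + |z|))` on a half-plane `Re
z ≤ β` with `β > 0` (`exists_R_bound`). Hence `q` is bounded there, `r` is Lipschitz in the distance
to the imaginary axis, and `eₙ`, `Eₙ` decay geometrically.

For the quadrature error, a norming functional reduces to a scalar integrand, which is analytic in
the right half-plane. When `[ℓ, (B + 1)ℓ]` is mapped to `[-1, 1]`, the Bernstein ellipse with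
parameter `g ε B` is the one whose left vertex corresponds to `εℓ`; there the integrand is bounded
through `(εℓ)^(-α)` and the two bounds for `eₙ` (`norm_extIntegrand_le`).

What remains is the Gauss error bound `8 M ρ^(-2Q)` (`norm_gaussError_le`), without the factor `(1 -
ρ⁻¹)⁻¹` that summing bounds of Chebyshev coefficients would cost. The error functional has norm at
most 4 and annihilates degree below `2Q`, so a polynomial approximation within `2 M ρ^(-2Q)`
suffices. Up to a small remainder, the tail of the Chebyshev series is obtained from the values of
`f` on the ellipse by convolution with a modulated nonnegative kernel, whose L¹ norm is just its
mean value (`norm_multiplier_le`, `gaussMult_add`).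

The minimum over `ε` is attained because the reciprocal of the bound is continuous on `[0, 1]`,
vanishes at 0, and increases when `ε` moves left from 1, where `g` has infinite slope. -/

lemma eval_iterate_derivative_sq_sub_one_pow {Q k : ℕ} (hk : k < Q) {a : ℝ} (ha : a ^ 2 = 1) :
    (derivative^[k] ((X ^ 2 - 1 : ℝ[X]) ^ Q)).eval a = 0 := by
  obtain ⟨u, hu⟩ := pow_sub_dvd_iterate_derivative_of_pow_dvd k
    (dvd_refl ((X ^ 2 - 1 : ℝ[X]) ^ Q))
  rw [hu]
  simp [ha, Nat.sub_ne_zero_of_lt hk]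

lemma intervalIntegrable_eval (p : ℝ[X]) (a b : ℝ) :
    IntervalIntegrable (fun x => p.eval x) MeasureTheory.volume a b :=
  p.continuous.intervalIntegrable a b

/-- Integration by parts moves one derivative at a time onto `p`. The boundary terms vanish because
`±1` remain zeros of every derivative of order below `Q`. -/
lemma integral_iterate_derivative_mul_eq_zero {Q j : ℕ} (hj : j ≤ Q) (p : ℝ[X])
    (hp : p.degree < j) :
    ∫ x in (-1 : ℝ)..1, (derivative^[j] ((X ^ 2 - 1 : ℝ[X]) ^ Q)).eval x * p.eval x = 0 := by
  induction j generalizing p with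
  | zero =>
    have : p = 0 := by simpa using hp
    simp [this]
  | succ j ih =>
    have hd : (derivative p).degree < j := by
      rcases eq_or_ne p 0 with rfl | h0
      · simp
      · have h1 := degree_derivative_lt h0
        have h2 : p.degree ≤ j := by
          rw [degree_eq_natDegree h0] at hp ⊢
          exact_mod_cast Nat.lt_succ_iff.mp (by exact_mod_cast hp)
        exact lt_of_lt_of_le h1 h2
    have h := intervalIntegral.integral_mul_deriv_eq_deriv_mul (a := (-1 : ℝ)) (b := 1)
      (u := fun x => p.eval x) (u' := fun x => (derivative p).eval x)
      (v := fun x => (derivative^[j] ((X ^ 2 - 1 : ℝ[X]) ^ Q)).eval x)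
      (v' := fun x => (derivative^[j + 1] ((X ^ 2 - 1 : ℝ[X]) ^ Q)).eval x)
      (fun x _ => p.hasDerivAt x)
      (fun x _ => by rw [Function.iterate_succ_apply']; exact Polynomial.hasDerivAt _ x)
      (intervalIntegrable_eval _ _ _) (intervalIntegrable_eval _ _ _)
    have ih' := ih (by omega) _ hd
    simp only [mul_comm] at h ih' ⊢
    rw [h, ih', eval_iterate_derivative_sq_sub_one_pow (by omega) (by norm_num),
      eval_iterate_derivative_sq_sub_one_pow (by omega) (by norm_num)]
    simp

lemma integral_legendre_mul_eq_zero {Q : ℕ} (p : ℝ[X]) (hp : p.degree < Q) :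
    ∫ x in (-1 : ℝ)..1, (legendre Q * p).eval x = 0 := by
  have := integral_iterate_derivative_mul_eq_zero le_rfl p hp
  simp only [legendre, eval_mul, eval_C, mul_assoc]
  rw [intervalIntegral.integral_const_mul, this, mul_zero]

lemma natDegree_sq_sub_one_pow (Q : ℕ) : ((X ^ 2 - 1 : ℝ[X]) ^ Q).natDegree = 2 * Q := by
  have : (X ^ 2 - 1 : ℝ[X]) = X ^ 2 - C 1 := by simp
  rw [natDegree_pow, this, natDegree_X_pow_sub_C, mul_comm]

lemma natDegree_iterate_derivative_sq_sub_one_pow (Q k : ℕ) :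
    (derivative^[k] ((X ^ 2 - 1 : ℝ[X]) ^ Q)).natDegree = 2 * Q - k := by
  induction k with
  | zero => rw [Function.iterate_zero_apply, natDegree_sq_sub_one_pow, Nat.sub_zero]
  | succ k ih => rw [Function.iterate_succ_apply', natDegree_derivative, ih]; omega

lemma iterate_derivative_sq_sub_one_pow_ne_zero {Q k : ℕ} (hk : k ≤ Q) (hQ : 1 ≤ Q) :
    derivative^[k] ((X ^ 2 - 1 : ℝ[X]) ^ Q) ≠ 0 := by
  intro h
  have := natDegree_iterate_derivative_sq_sub_one_pow Q k
  rw [h, natDegree_zero] at this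
  omega

/-- Rolle's theorem yields `k + 1` zeros of the next derivative that are not zeros of the present
one, and `±1` are zeros of both as long as the order stays below `Q`. -/
lemma add_two_le_card_roots_iterate_derivative {Q k : ℕ} (hk : k < Q) :
    k + 2 ≤ (derivative^[k] ((X ^ 2 - 1 : ℝ[X]) ^ Q)).roots.toFinset.card := by
  have hroot : ∀ j, j < Q →
      ({1, -1} : Finset ℝ) ⊆ (derivative^[j] ((X ^ 2 - 1 : ℝ[X]) ^ Q)).roots.toFinset := by
    intro j hj a ha
    have ha' : a ^ 2 = 1 := by
      rcases Finset.mem_insert.mp ha with rfl | h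
      · norm_num
      · rw [Finset.mem_singleton.mp h]; norm_num
    rw [Multiset.mem_toFinset, mem_roots (iterate_derivative_sq_sub_one_pow_ne_zero hj.le (by omega))]
    exact eval_iterate_derivative_sq_sub_one_pow hj ha'
  have hcard : ({1, -1} : Finset ℝ).card = 2 := Finset.card_pair (by norm_num)
  induction k with
  | zero =>
    have := Finset.card_le_card (hroot 0 hk)
    omega
  | succ k ih =>
    have ih := ih (by omega)
    have h1 := card_roots_toFinset_le_card_roots_derivative_sdiff_roots_succ
      (derivative^[k] ((X ^ 2 - 1 : ℝ[X]) ^ Q))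
    rw [← Function.iterate_succ_apply' (⇑derivative)] at h1
    set S := (derivative^[k + 1] ((X ^ 2 - 1 : ℝ[X]) ^ Q)).roots.toFinset
    set T := (derivative^[k] ((X ^ 2 - 1 : ℝ[X]) ^ Q)).roots.toFinset
    have h2 : (S \ T).card + (S ∩ T).card = S.card := Finset.card_sdiff_add_card_inter S T
    have h3 : ({1, -1} : Finset ℝ).card ≤ (S ∩ T).card :=
      Finset.card_le_card (Finset.subset_inter (hroot _ hk) (hroot _ (by omega)))
    omega

lemma legendre_ne_zero (Q : ℕ) : legendre Q ≠ 0 := by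
  rcases Nat.eq_zero_or_pos Q with rfl | hQ
  · simp [legendre]
  · exact mul_ne_zero (C_ne_zero.mpr (by positivity))
      (iterate_derivative_sq_sub_one_pow_ne_zero le_rfl hQ)

lemma natDegree_legendre (Q : ℕ) : (legendre Q).natDegree = Q := by
  rw [legendre, natDegree_C_mul (by positivity), natDegree_iterate_derivative_sq_sub_one_pow]
  omega

lemma card_gaussNodes (Q : ℕ) : (gaussNodes Q).card = Q := by
  rcases Nat.eq_zero_or_pos Q with rfl | hQ
  · simp [gaussNodes, legendre]
  apply le_antisymm
  · calc (gaussNodes Q).card ≤ Multiset.card (legendre Q).roots := Multiset.toFinset_card_le _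
      _ ≤ (legendre Q).natDegree := card_roots' _
      _ = Q := natDegree_legendre Q
  · obtain ⟨k, rfl⟩ : ∃ k, Q = k + 1 := ⟨Q - 1, by omega⟩
    have h1 := add_two_le_card_roots_iterate_derivative (Nat.lt_add_one k)
    have h2 := card_roots_toFinset_le_derivative
      (derivative^[k] ((X ^ 2 - 1 : ℝ[X]) ^ (k + 1)))
    rw [← Function.iterate_succ_apply' (⇑derivative), Nat.succ_eq_add_one] at h2
    rw [gaussNodes, legendre, roots_C_mul _ (by positivity)]
    omega

lemma eval_legendre_eq_zero {Q : ℕ} {y : ℝ} (hy : y ∈ gaussNodes Q) : (legendre Q).eval y = 0 := by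
  rw [gaussNodes, Multiset.mem_toFinset, mem_roots (legendre_ne_zero Q)] at hy
  exact hy

lemma integral_sq_mul_pos {p u : ℝ[X]} (hp : ∀ x ∈ Set.Ioo (-1 : ℝ) 1, 0 < p.eval x)
    (hu : u ≠ 0) : 0 < ∫ x in (-1 : ℝ)..1, (p * u ^ 2).eval x := by
  have hp' : ∀ x ∈ Set.Ioc (-1 : ℝ) 1, 0 ≤ (p * u ^ 2).eval x := by
    have hc : ∀ x ∈ closure (Set.Ioo (-1 : ℝ) 1), 0 ≤ p.eval x :=
      fun x hx => closure_minimal (fun z hz => (hp z hz).le)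
        (isClosed_le continuous_const p.continuous) hx
    rw [closure_Ioo (by norm_num)] at hc
    intro x hx
    rw [eval_mul, eval_pow]
    exact mul_nonneg (hc x ⟨hx.1.le, hx.2⟩) (sq_nonneg _)
  obtain ⟨c, hc, hc0⟩ : ∃ c ∈ Set.Ioo (-1 : ℝ) 1, u.eval c ≠ 0 := by
    by_contra! h
    exact hu (eq_zero_of_infinite_isRoot u ((Set.Ioo_infinite (by norm_num)).mono h))
  refine intervalIntegral.integral_pos (by norm_num) (Polynomial.continuous _).continuousOn hp'
    ⟨c, ⟨hc.1.le, hc.2.le⟩, ?_⟩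
  rw [eval_mul, eval_pow]
  have := hp c hc
  positivity

/-- If `y` lay outside, `legendre Q = (X - y) u` would be orthogonal to `u`, although `(X - y) u²`
has constant sign on `(-1, 1)`. -/
lemma mem_Ioo_of_mem_gaussNodes {Q : ℕ} {y : ℝ} (hy : y ∈ gaussNodes Q) :
    y ∈ Set.Ioo (-1 : ℝ) 1 := by
  obtain ⟨u, hu⟩ := dvd_iff_isRoot.mpr (eval_legendre_eq_zero hy)
  have hu0 : u ≠ 0 := by
    rintro rfl
    exact legendre_ne_zero Q (by simpa using hu)
  have hdeg : u.degree < Q := by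
    have h1 := natDegree_legendre Q
    rw [hu, natDegree_mul (X_sub_C_ne_zero y) hu0, natDegree_X_sub_C] at h1
    rw [degree_eq_natDegree hu0]
    exact_mod_cast (by omega : u.natDegree < Q)
  have h0 := integral_legendre_mul_eq_zero u hdeg
  rw [hu, mul_assoc, ← sq] at h0
  by_contra hy'
  rcases not_and_or.mp hy' with h | h
  · have := integral_sq_mul_pos (p := X - C y) (u := u)
      (fun x hx => by simp only [eval_sub, eval_X, eval_C]; linarith [hx.1]) hu0
    linarith
  · have := integral_sq_mul_pos (p := -(X - C y)) (u := u)
      (fun x hx => by simp only [eval_neg, eval_sub, eval_X, eval_C]; linarith [hx.2]) hu0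
    simp only [neg_mul, eval_neg, intervalIntegral.integral_neg] at this
    linarith

lemma integral_eq_gauss_of_degree_lt {Q : ℕ} (p : ℝ[X]) (hp : p.degree < Q) :
    ∫ x in (-1 : ℝ)..1, p.eval x = ∑ y ∈ gaussNodes Q, gaussWeight Q y * p.eval y := by
  have h := Lagrange.eq_interpolate (s := gaussNodes Q) (v := id) (f := p)
    (Set.injOn_id _) (by rwa [card_gaussNodes])
  conv_lhs => rw [h]
  simp only [Lagrange.interpolate_apply, eval_finsetSum, eval_mul, eval_C, id]
  rw [intervalIntegral.integral_finsetSum]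
  · refine Finset.sum_congr rfl fun y _ => ?_
    rw [intervalIntegral.integral_const_mul, mul_comm]
    rfl
  · intro y _
    exact (intervalIntegrable_eval _ _ _).const_mul _

/-- The `Q`-point Gauss-Legendre rule is exact for polynomials of degree less than `2 * Q`. -/
lemma integral_eq_gauss {Q : ℕ} (p : ℝ[X]) (hp : p.natDegree < 2 * Q) :
    ∫ x in (-1 : ℝ)..1, p.eval x = ∑ y ∈ gaussNodes Q, gaussWeight Q y * p.eval y := by
  have hL := legendre_ne_zero Q
  have hdecomp := EuclideanDomain.div_add_mod p (legendre Q)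
  have hmod : (p % legendre Q).degree < Q := by
    have := EuclideanDomain.mod_lt p hL
    have h2 : (p % legendre Q).degree < (legendre Q).degree := this
    rwa [degree_eq_natDegree hL, natDegree_legendre] at h2
  have hdiv : (p / legendre Q).degree < Q := by
    by_cases h0 : p / legendre Q = 0
    · rw [h0, degree_zero]; exact WithBot.bot_lt_coe _
    have hle : (legendre Q).degree ≤ p.degree := by
      by_contra! hlt
      exact h0 ((Polynomial.div_eq_zero_iff hL).mpr hlt)
    have hp0 : p ≠ 0 := by rintro rfl; simp at h0
    have hadd := degree_add_div hL hle
    rw [degree_eq_natDegree hL, degree_eq_natDegree h0, degree_eq_natDegree hp0,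
      natDegree_legendre] at hadd
    have hadd' : Q + (p / legendre Q).natDegree = p.natDegree := by exact_mod_cast hadd
    rw [degree_eq_natDegree h0]
    exact_mod_cast (by omega : (p / legendre Q).natDegree < Q)
  have h1 : ∫ x in (-1 : ℝ)..1, p.eval x
      = ∫ x in (-1 : ℝ)..1, (p % legendre Q).eval x := by
    conv_lhs => rw [← hdecomp]
    simp only [eval_add]
    rw [intervalIntegral.integral_add (intervalIntegrable_eval _ _ _)
      (intervalIntegrable_eval _ _ _), integral_legendre_mul_eq_zero _ hdiv, zero_add]
  rw [h1, integral_eq_gauss_of_degree_lt _ hmod]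
  refine Finset.sum_congr rfl fun y hy => ?_
  conv_rhs => rw [← hdecomp]
  rw [eval_add, eval_mul, eval_legendre_eq_zero hy, zero_mul, zero_add]

/-- The rule is exact for the square of the Lagrange basis polynomial, so the weight is the integral
of that square. -/
lemma gaussWeight_nonneg {Q : ℕ} {y : ℝ} (hy : y ∈ gaussNodes Q) : 0 ≤ gaussWeight Q y := by
  have hQ : 0 < Q := by
    rw [← card_gaussNodes Q]; exact Finset.card_pos.mpr ⟨y, hy⟩
  set l := Lagrange.basis (gaussNodes Q) id y
  have hd : l.natDegree = Q - 1 := by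
    have := Lagrange.degree_basis (s := gaussNodes Q) (v := id) (Set.injOn_id _) hy
    rw [card_gaussNodes] at this
    exact natDegree_eq_of_degree_eq_some this
  have h := integral_eq_gauss (Q := Q) (l ^ 2) (by rw [natDegree_pow, hd]; omega)
  rw [Finset.sum_eq_single_of_mem y hy] at h
  · have h1 : l.eval y = 1 := Lagrange.eval_basis_self (v := id) (Set.injOn_id _) hy
    rw [eval_pow, h1, one_pow, mul_one] at h
    rw [← h]
    refine intervalIntegral.integral_nonneg (by norm_num) fun x _ => ?_
    rw [eval_pow]
    positivity
  · intro z hz hne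
    have h0 : l.eval z = 0 := Lagrange.eval_basis_of_ne (v := id) hne.symm hz
    rw [eval_pow, h0]
    simp

lemma sum_gaussWeight {Q : ℕ} (hQ : 1 ≤ Q) : ∑ y ∈ gaussNodes Q, gaussWeight Q y = 2 := by
  have h := integral_eq_gauss (Q := Q) 1 (by rw [natDegree_one]; omega)
  simp only [eval_one, mul_one] at h
  rw [← h]
  norm_num

/-! ### Fourier multipliers with a nonnegative kernel -/

/-- The character `θ ↦ e^(i k θ)`. -/
noncomputable def expI (k : ℤ) (θ : ℝ) : ℂ := Complex.exp (k * θ * Complex.I)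

lemma norm_expI (k : ℤ) (θ : ℝ) : ‖expI k θ‖ = 1 := by
  have : (k : ℂ) * θ * Complex.I = ((k * θ : ℝ) : ℂ) * Complex.I := by push_cast; ring
  rw [expI, this, Complex.norm_exp_ofReal_mul_I]

lemma continuous_expI (k : ℤ) : Continuous (expI k) := by
  unfold expI; fun_prop

lemma expI_add_left (k l : ℤ) (θ : ℝ) : expI (k + l) θ = expI k θ * expI l θ := by
  rw [expI, expI, expI, ← Complex.exp_add]; push_cast; ring_nf

lemma expI_sub_right (k : ℤ) (θ t : ℝ) : expI k (θ - t) = expI k θ * expI (-k) t := by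
  rw [expI, expI, expI, ← Complex.exp_add]; push_cast; ring_nf

lemma expI_neg_left (k : ℤ) (θ : ℝ) : expI (-k) θ = expI k (-θ) := by
  rw [expI, expI]; push_cast; ring_nf

lemma expI_nat (k : ℕ) (θ : ℝ) : expI k θ = expI 1 θ ^ k := by
  rw [expI, expI, ← Complex.exp_nat_mul]; push_cast; ring_nf

lemma expI_zero_left (θ : ℝ) : expI 0 θ = 1 := by simp [expI]

lemma expI_add_expI_neg (k : ℤ) (θ : ℝ) : expI k θ + expI k (-θ) = 2 * Complex.cos (k * θ) := by
  rw [expI, expI, Complex.cos]; push_cast; ring_nf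

lemma expI_periodic (k : ℤ) : Function.Periodic (expI k) (2 * Real.pi) := by
  intro θ
  have : (k : ℂ) * ((θ + 2 * Real.pi : ℝ) : ℂ) * Complex.I
      = k * θ * Complex.I + k * (2 * Real.pi * Complex.I) := by push_cast; ring
  rw [expI, this, Complex.exp_add, Complex.exp_int_mul_two_pi_mul_I, mul_one, expI]

/-- The `k`-th Fourier coefficient of a function of period `2π`. -/
noncomputable def fcoeff (φ : ℝ → ℂ) (k : ℤ) : ℂ :=
  (2 * Real.pi : ℂ)⁻¹ * ∫ t in (0 : ℝ)..2 * Real.pi, φ t * expI (-k) t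

lemma norm_fcoeff_le {φ : ℝ → ℂ} {M : ℝ} (hM : ∀ t, ‖φ t‖ ≤ M) (k : ℤ) : ‖fcoeff φ k‖ ≤ M := by
  have h : ‖∫ t in (0 : ℝ)..2 * Real.pi, φ t * expI (-k) t‖ ≤ M * |2 * Real.pi - 0| :=
    intervalIntegral.norm_integral_le_of_norm_le_const fun t _ => by
      rw [norm_mul, norm_expI, mul_one]; exact hM t
  have hpi := Real.pi_pos
  rw [sub_zero, abs_of_pos (by positivity)] at h
  rw [fcoeff, norm_mul]
  have h2 : ‖(2 * Real.pi : ℂ)⁻¹‖ = (2 * Real.pi)⁻¹ := by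
    rw [norm_inv, norm_mul, Complex.norm_real, Real.norm_of_nonneg hpi.le]; simp
  rw [h2]
  calc (2 * Real.pi)⁻¹ * _ ≤ (2 * Real.pi)⁻¹ * (M * (2 * Real.pi)) := by gcongr
    _ = M := by field_simp

/-- The series of `w` is integrated term by term against `φ`. The factor `expI n` shifts the
multiplier by `n` while leaving the modulus of the kernel unchanged. -/
lemma hasSum_multiplier {c : ℤ → ℝ} (hc : Summable c) {w : ℝ → ℝ}
    (hs : ∀ τ, HasSum (fun k => (c k : ℂ) * expI k τ) (w τ)) {φ : ℝ → ℂ} (hφ : Continuous φ)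
    {M : ℝ} (hM : ∀ t, ‖φ t‖ ≤ M) (n : ℤ) (θ : ℝ) :
    HasSum (fun k => (c (k - n) : ℂ) * fcoeff φ k * expI k θ)
      ((2 * Real.pi : ℂ)⁻¹ * ∫ t in (0 : ℝ)..2 * Real.pi, φ t * (expI n (θ - t) * w (θ - t))) := by
  have hcn : Summable fun k => |c (k - n)| :=
    (Equiv.subRight n).summable_iff.mpr hc.abs
  have key := intervalIntegral.hasSum_integral_of_dominated_convergence
    (μ := MeasureTheory.volume) (a := 0) (b := 2 * Real.pi)
    (F := fun (k : ℤ) (t : ℝ) => (c (k - n) : ℂ) * (φ t * expI k (θ - t)))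
    (f := fun t => φ t * (expI n (θ - t) * w (θ - t)))
    (fun k _ => |c (k - n)| * M)
    (fun k => by
      have := continuous_expI k
      exact (by fun_prop : Continuous _).aestronglyMeasurable)
    (fun k => Filter.Eventually.of_forall fun t _ => by
      rw [norm_mul, norm_mul, norm_expI, mul_one, Complex.norm_real, Real.norm_eq_abs]
      exact mul_le_mul_of_nonneg_left (hM t) (abs_nonneg _))
    (Filter.Eventually.of_forall fun t _ => hcn.mul_right M)
    (intervalIntegrable_const)
    (Filter.Eventually.of_forall fun t _ => by
      have h1 := (((Equiv.subRight n).hasSum_iff).mpr (hs (θ - t))).mul_left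
        (φ t * expI n (θ - t))
      rw [mul_assoc] at h1
      refine h1.congr_fun fun k => ?_
      have := expI_add_left n (k - n) (θ - t)
      rw [add_sub_cancel] at this
      simp only [Function.comp, Equiv.subRight_apply, this]
      ring)
  refine (key.mul_left ((2 * Real.pi : ℂ)⁻¹)).congr_fun fun k => ?_
  rw [intervalIntegral.integral_const_mul, fcoeff]
  have : ∀ t, φ t * expI k (θ - t) = (φ t * expI (-k) t) * expI k θ := fun t => by
    rw [expI_sub_right]; ring
  simp only [this]
  rw [intervalIntegral.integral_mul_const]
  ring

/-- This is the multiplier formula for the constant function 1, of which only the coefficient at 0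
survives. -/
lemma integral_kernel {c : ℤ → ℝ} (hc : Summable c) {w : ℝ → ℝ}
    (hs : ∀ τ, HasSum (fun k => (c k : ℂ) * expI k τ) (w τ)) (θ : ℝ) :
    ∫ t in (0 : ℝ)..2 * Real.pi, w (θ - t) = 2 * Real.pi * c 0 := by
  have h := hasSum_multiplier hc hs (φ := fun _ => 1) continuous_const
    (M := 1) (fun _ => by simp) 0 θ
  have hpi : (Real.pi : ℂ) ≠ 0 := by exact_mod_cast Real.pi_ne_zero
  have hz : ∀ k : ℤ, k ≠ 0 → fcoeff (fun _ => 1) k = 0 := by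
    intro k hk
    have hk' : (-k : ℂ) * Complex.I ≠ 0 := by simp [hk]
    have h1 : ∀ t : ℝ, (1 : ℂ) * expI (-k) t = Complex.exp ((-k : ℂ) * Complex.I * t) := fun t => by
      rw [expI, one_mul]; push_cast; ring_nf
    simp only [fcoeff, h1]
    rw [integral_exp_mul_complex hk']
    have h2 : (-k : ℂ) * Complex.I * ((2 * Real.pi : ℝ) : ℂ)
        = ((-k : ℤ) : ℂ) * (2 * Real.pi * Complex.I) := by
      push_cast; ring
    rw [h2, Complex.exp_int_mul_two_pi_mul_I]
    simp
  have h0 : fcoeff (fun _ => 1) 0 = 1 := by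
    simp only [fcoeff, neg_zero, expI_zero_left, mul_one]
    rw [intervalIntegral.integral_const]
    simp only [sub_zero, Complex.real_smul, mul_one]
    push_cast
    exact inv_mul_cancel₀ (by simp [hpi])
  have h' := hasSum_single (f := fun k => (c (k - 0) : ℂ) * fcoeff (fun _ => 1) k * expI k θ) 0
    (fun k hk => by simp [hz k hk])
  have := h.unique h'
  simp only [sub_zero, h0, expI_zero_left, mul_one, one_mul] at this
  rw [intervalIntegral.integral_ofReal, inv_mul_eq_iff_eq_mul₀ (by simp [hpi])] at this
  exact_mod_cast this

/-- For a nonnegative kernel the L¹ norm equals the mean value, that is, the single coefficient `c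
0`. -/
lemma norm_multiplier_le {c : ℤ → ℝ} (hc : Summable c) {w : ℝ → ℝ} (hw : Continuous w)
    (hw0 : ∀ τ, 0 ≤ w τ) (hs : ∀ τ, HasSum (fun k => (c k : ℂ) * expI k τ) (w τ))
    {φ : ℝ → ℂ} (hφ : Continuous φ) {M : ℝ} (hM : ∀ t, ‖φ t‖ ≤ M) (n : ℤ) (θ : ℝ) :
    ‖∑' k, (c (k - n) : ℂ) * fcoeff φ k * expI k θ‖ ≤ M * c 0 := by
  rw [(hasSum_multiplier hc hs hφ hM n θ).tsum_eq]
  have hpi := Real.pi_pos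
  have h : ‖∫ t in (0 : ℝ)..2 * Real.pi, φ t * (expI n (θ - t) * w (θ - t))‖
      ≤ ∫ t in (0 : ℝ)..2 * Real.pi, M * w (θ - t) :=
    intervalIntegral.norm_integral_le_of_norm_le (by positivity)
      (Filter.Eventually.of_forall fun t _ => by
        rw [norm_mul, norm_mul, norm_expI, one_mul, Complex.norm_real,
          Real.norm_of_nonneg (hw0 _)]
        exact mul_le_mul_of_nonneg_right (hM t) (hw0 _))
      (Continuous.intervalIntegrable (by fun_prop) _ _)
  rw [intervalIntegral.integral_const_mul, integral_kernel hc hs] at h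
  have h2 : ‖(2 * Real.pi : ℂ)⁻¹‖ = (2 * Real.pi)⁻¹ := by
    rw [norm_inv, norm_mul, Complex.norm_real, Real.norm_of_nonneg hpi.le]; simp
  rw [norm_mul, h2]
  calc (2 * Real.pi)⁻¹ * _ ≤ (2 * Real.pi)⁻¹ * (M * (2 * Real.pi * c 0)) := by gcongr
    _ = M * c 0 := by field_simp

/-- The Poisson kernel of the unit disc as a function of radius and angle. -/
noncomputable def poisson (s τ : ℝ) : ℝ := (1 - s ^ 2) / (1 - 2 * s * Real.cos τ + s ^ 2)

lemma poisson_denom_pos {s : ℝ} (h0 : 0 < s) (h1 : s < 1) (τ : ℝ) :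
    0 < 1 - 2 * s * Real.cos τ + s ^ 2 := by
  nlinarith [Real.cos_le_one τ, sq_pos_of_pos (sub_pos.mpr h1)]

lemma poisson_nonneg {s : ℝ} (h0 : 0 < s) (h1 : s < 1) (τ : ℝ) : 0 ≤ poisson s τ :=
  div_nonneg (by nlinarith) (poisson_denom_pos h0 h1 τ).le

lemma continuous_poisson {s : ℝ} (h0 : 0 < s) (h1 : s < 1) : Continuous (poisson s) := by
  unfold poisson
  exact Continuous.div (by fun_prop) (by fun_prop) fun τ => (poisson_denom_pos h0 h1 τ).ne'

/-- The Poisson kernel as two geometric series, over `k ≥ 0` and `k ≤ 0`; `d` is the term `k = 0`,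
which both contain. -/
lemma inv_add_inv_sub_one {s a b c d : ℂ} (ha : 1 - s * a ≠ 0) (hb : 1 - s * b ≠ 0)
    (hab : a * b = 1) (hc : a + b = 2 * c) (hd : d = 1) :
    (1 - s * a)⁻¹ + (1 - s * b)⁻¹ - d = (1 - s ^ 2) / (1 - 2 * s * c + s ^ 2) := by
  have hden : 1 - 2 * s * c + s ^ 2 = (1 - s * a) * (1 - s * b) := by
    linear_combination s * hc - s ^ 2 * hab
  rw [hden, hd, eq_div_iff (mul_ne_zero ha hb), sub_mul, add_mul, inv_mul_cancel_left₀ ha,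
    mul_comm (1 - s * a), inv_mul_cancel_left₀ hb]
  linear_combination -s ^ 2 * hab

lemma hasSum_poisson {s : ℝ} (h0 : 0 < s) (h1 : s < 1) (τ : ℝ) :
    HasSum (fun k : ℤ => ((s ^ k.natAbs : ℝ) : ℂ) * expI k τ) (poisson s τ) := by
  have hn : ∀ t : ℝ, ‖(s : ℂ) * expI 1 t‖ < 1 := fun t => by
    rw [norm_mul, norm_expI, Complex.norm_real, Real.norm_of_nonneg h0.le, mul_one]; exact h1
  have nz : ∀ t : ℝ, 1 - (s : ℂ) * expI 1 t ≠ 0 := fun t h => by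
    have := hn t
    rw [← sub_eq_zero.mp h, norm_one] at this
    exact lt_irrefl _ this
  have hprod : expI 1 τ * expI 1 (-τ) = 1 := by
    rw [← expI_neg_left, ← expI_add_left, add_neg_cancel, expI_zero_left]
  have hsum := expI_add_expI_neg 1 τ
  rw [Int.cast_one, one_mul] at hsum
  have hterm : ∀ (k : ℕ) (t : ℝ), ((s ^ k : ℝ) : ℂ) * expI k t = ((s : ℂ) * expI 1 t) ^ k :=
    fun k t => by rw [expI_nat, mul_pow, Complex.ofReal_pow]
  have h := HasSum.of_nat_of_neg
    (f := fun k : ℤ => ((s ^ k.natAbs : ℝ) : ℂ) * expI k τ)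
    (g := (1 - (s : ℂ) * expI 1 τ)⁻¹) (g' := (1 - (s : ℂ) * expI 1 (-τ))⁻¹)
    (by simpa only [Int.natAbs_natCast, hterm] using hasSum_geometric_of_norm_lt_one (hn τ))
    (by simpa only [Int.natAbs_neg, Int.natAbs_natCast, expI_neg_left, hterm] using
      hasSum_geometric_of_norm_lt_one (hn (-τ)))
  have h0' : ((s ^ (0 : ℤ).natAbs : ℝ) : ℂ) * expI 0 τ = 1 := by
    rw [expI_zero_left, Int.natAbs_zero, pow_zero, Complex.ofReal_one, mul_one]
  have hv : (poisson s τ : ℂ) = (1 - (s : ℂ) ^ 2) / (1 - 2 * s * Complex.cos τ + (s : ℂ) ^ 2) := by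
    rw [poisson]; push_cast; rfl
  rw [hv, ← inv_add_inv_sub_one (nz τ) (nz (-τ)) hprod hsum h0']
  exact h

/-- After clearing denominators the inequality is affine in `cos τ`, so it is enough to check `cos τ
= ±1`. The 3 bounds `1 + s² + s⁴`, the quotient of the numerators. -/
lemma poisson_cube_le {s : ℝ} (h0 : 0 < s) (h1 : s < 1) (τ : ℝ) :
    poisson (s ^ 3) τ ≤ 3 * poisson s τ := by
  have hs3 : s ^ 3 < 1 := pow_lt_one₀ h0.le h1 (by norm_num)
  have d1 := poisson_denom_pos h0 h1 τ
  have d3 := poisson_denom_pos (pow_pos h0 3) hs3 τ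
  have hc1 := Real.cos_le_one τ
  have hc2 := Real.neg_one_le_cos τ
  rw [poisson, poisson, mul_div_assoc', div_le_div_iff₀ d3 d1]
  set c := Real.cos τ
  have e : 1 - (s ^ 3) ^ 2 = (1 - s ^ 2) * (1 + s ^ 2 + s ^ 4) := by ring
  have key : (1 + s ^ 2 + s ^ 4) * (1 - 2 * s * c + s ^ 2)
      ≤ 3 * (1 - 2 * s ^ 3 * c + (s ^ 3) ^ 2) := by
    have p1 : 0 ≤ 3 * (1 - 2 * s ^ 3 * 1 + (s ^ 3) ^ 2)
        - (1 + s ^ 2 + s ^ 4) * (1 - 2 * s * 1 + s ^ 2) := by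
      have : 3 * (1 - 2 * s ^ 3 * 1 + (s ^ 3) ^ 2)
        - (1 + s ^ 2 + s ^ 4) * (1 - 2 * s * 1 + s ^ 2)
        = (1 - s) ^ 2 * (1 + s + s ^ 2) * (2 * (1 + s) ^ 2) := by ring
      rw [this]; positivity
    have p2 : 0 ≤ 3 * (1 - 2 * s ^ 3 * (-1) + (s ^ 3) ^ 2)
        - (1 + s ^ 2 + s ^ 4) * (1 - 2 * s * (-1) + s ^ 2) := by
      have : 3 * (1 - 2 * s ^ 3 * (-1) + (s ^ 3) ^ 2)
        - (1 + s ^ 2 + s ^ 4) * (1 - 2 * s * (-1) + s ^ 2)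
        = (1 + s) ^ 2 * (1 - s + s ^ 2) * (2 * (1 - s) ^ 2) := by ring
      have h3 : 0 ≤ 1 - s + s ^ 2 := by nlinarith
      rw [this]; positivity
    nlinarith [mul_nonneg p1 (by linarith : 0 ≤ 1 + c), mul_nonneg p2 (by linarith : 0 ≤ 1 - c)]
  rw [e]
  have : 0 ≤ 1 - s ^ 2 := by nlinarith
  nlinarith [mul_le_mul_of_nonneg_left key this]

/-! ### Fourier expansion of a function analytic in a Bernstein ellipse -/

lemma hasSum_fcoeff {φ : ℝ → ℂ} (hφ : Continuous φ) (hp : Function.Periodic φ (2 * Real.pi))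
    (hs : Summable (fcoeff φ)) (θ : ℝ) : HasSum (fun k => fcoeff φ k * expI k θ) (φ θ) := by
  have hpi := Real.pi_pos
  have : Fact (0 < 2 * Real.pi) := ⟨by positivity⟩
  let Φ : C(AddCircle (2 * Real.pi), ℂ) := ⟨hp.lift, continuous_coinduced_dom.mpr hφ⟩
  have hΦ : ∀ t : ℝ, Φ (t : AddCircle (2 * Real.pi)) = φ t := fun t => hp.lift_coe t
  have hfour : ∀ (k : ℤ) (t : ℝ), fourier k (t : AddCircle (2 * Real.pi)) = expI k t := by
    intro k t
    have : (Real.pi : ℂ) ≠ 0 := by exact_mod_cast hpi.ne'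
    rw [fourier_coe_apply, expI]
    congr 1
    push_cast
    field_simp
  have hcoef : ∀ k, fourierCoeff Φ k = fcoeff φ k := by
    intro k
    rw [fourierCoeff_eq_intervalIntegral _ _ 0, fcoeff, zero_add, Complex.real_smul]
    push_cast
    rw [one_div]
    congr 1
    refine intervalIntegral.integral_congr fun t _ => ?_
    simp only [hΦ, hfour, smul_eq_mul, mul_comm]
  have hsum : Summable (fourierCoeff Φ) := by
    rw [show fourierCoeff Φ = fcoeff φ from funext hcoef]; exact hs
  have h := has_pointwise_sum_fourier_series_of_summable hsum (θ : AddCircle (2 * Real.pi))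
  simpa only [hcoef, hfour, hΦ, smul_eq_mul] using h

lemma fcoeff_neg_of_even {φ : ℝ → ℂ} (hp : Function.Periodic φ (2 * Real.pi))
    (he : ∀ t, φ (-t) = φ t) (k : ℤ) : fcoeff φ (-k) = fcoeff φ k := by
  rw [fcoeff, fcoeff]
  congr 1
  have h := intervalIntegral.integral_comp_sub_left (a := 0) (b := 2 * Real.pi)
    (fun t => φ t * expI (-k) t) (2 * Real.pi)
  rw [sub_self, sub_zero] at h
  rw [← h]
  refine intervalIntegral.integral_congr fun t _ => ?_
  have h1 : φ (2 * Real.pi - t) = φ t := by rw [hp.sub_eq', he]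
  have h2 : expI (-k) (2 * Real.pi - t) = expI (-(-k)) t := by
    rw [(expI_periodic _).sub_eq', expI_neg_left (-k) t]
  simp only [h1, h2]

lemma circleIntegral_mul_zpow {F : ℂ → ℂ} {R : ℝ} (hR : 0 < R) (k : ℤ) :
    (∮ u in C(0, R), F u * u ^ (-k - 1))
      = Complex.I * (R : ℂ) ^ (-k) * (2 * Real.pi) * fcoeff (fun t => F (R * expI 1 t)) k := by
  have hpi : (Real.pi : ℂ) ≠ 0 := by exact_mod_cast Real.pi_ne_zero
  have hR' : (R : ℂ) ≠ 0 := by exact_mod_cast hR.ne'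
  have hmap : ∀ t, circleMap 0 R t = R * expI 1 t := fun t => by
    simp [circleMap, expI]
  have hexp : ∀ t, expI 1 t ≠ 0 := fun t => Complex.exp_ne_zero _
  have hpow : ∀ t, expI (-k) t = expI 1 t ^ (-k) := fun t => by
    rw [expI, expI, ← Complex.exp_int_mul]; push_cast; ring_nf
  rw [circleIntegral, fcoeff]
  have : ∀ t, deriv (circleMap 0 R) t • (F (circleMap 0 R t) * circleMap 0 R t ^ (-k - 1))
      = (Complex.I * (R : ℂ) ^ (-k)) * (F (R * expI 1 t) * expI (-k) t) := by
    intro t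
    have he := hexp t
    have hne : (R : ℂ) * expI 1 t ≠ 0 := mul_ne_zero hR' he
    rw [deriv_circleMap, hmap, smul_eq_mul, zpow_sub_one₀ hne, mul_zpow, hpow]
    field_simp
  simp only [this]
  rw [intervalIntegral.integral_const_mul]
  field_simp

lemma joukowski_expI (t : ℝ) : (expI 1 t + (expI 1 t)⁻¹) / 2 = (Real.cos t : ℂ) := by
  have h1 : (expI 1 t)⁻¹ = expI 1 (-t) := by
    rw [expI, expI, ← Complex.exp_neg]; push_cast; ring_nf
  rw [h1, expI_add_expI_neg]
  push_cast
  ring_nf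

/-- `f` is complex differentiable and bounded by `M` on the closed region bounded by the Bernstein
ellipse with parameter `ρ`, the image of `ρ⁻¹ ≤ |u| ≤ ρ` under the Joukowski map. -/
def BoundedOnEllipse (f : ℂ → ℂ) (ρ M : ℝ) : Prop :=
  ∀ u : ℂ, ρ⁻¹ ≤ ‖u‖ → ‖u‖ ≤ ρ →
    DifferentiableAt ℂ f ((u + u⁻¹) / 2) ∧ ‖f ((u + u⁻¹) / 2)‖ ≤ M

namespace BoundedOnEllipse

variable {f : ℂ → ℂ} {ρ M : ℝ}

lemma at_cos (hf : BoundedOnEllipse f ρ M) (hρ : 1 < ρ) (t : ℝ) :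
    DifferentiableAt ℂ f (Real.cos t) ∧ ‖f (Real.cos t)‖ ≤ M := by
  have := hf (expI 1 t) (by rw [norm_expI]; exact inv_le_one_of_one_le₀ hρ.le)
    (by rw [norm_expI]; exact hρ.le)
  rwa [joukowski_expI] at this

lemma continuous_comp_cos (hf : BoundedOnEllipse f ρ M) (hρ : 1 < ρ) :
    Continuous fun t : ℝ => f (Real.cos t) :=
  continuous_iff_continuousAt.mpr fun t =>
    ContinuousAt.comp (f := fun t : ℝ => ((Real.cos t : ℝ) : ℂ)) (hf.at_cos hρ t).1.continuousAt
      (Complex.continuous_ofReal.comp Real.continuous_cos).continuousAt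

lemma at_outer (hf : BoundedOnEllipse f ρ M) (hρ : 1 < ρ) (t : ℝ) :
    DifferentiableAt ℂ f ((ρ * expI 1 t + (ρ * expI 1 t)⁻¹) / 2)
      ∧ ‖f ((ρ * expI 1 t + (ρ * expI 1 t)⁻¹) / 2)‖ ≤ M := by
  have hn : ‖(ρ : ℂ) * expI 1 t‖ = ρ := by
    rw [norm_mul, norm_expI, mul_one, Complex.norm_real, Real.norm_of_nonneg (by linarith)]
  exact hf _ (by rw [hn]; exact (inv_le_one_of_one_le₀ hρ.le).trans hρ.le) hn.le

lemma continuous_outer (hf : BoundedOnEllipse f ρ M) (hρ : 1 < ρ) :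
    Continuous fun t : ℝ => f ((ρ * expI 1 t + (ρ * expI 1 t)⁻¹) / 2) := by
  refine continuous_iff_continuousAt.mpr fun t => ?_
  have hc := (continuous_expI 1).continuousAt (x := t)
  have hne : (ρ : ℂ) * expI 1 t ≠ 0 :=
    mul_ne_zero (by exact_mod_cast (by linarith : ρ ≠ 0)) (Complex.exp_ne_zero _)
  exact ContinuousAt.comp (f := fun t : ℝ => ((ρ * expI 1 t + (ρ * expI 1 t)⁻¹) / 2 : ℂ))
    (hf.at_outer hρ t).1.continuousAt (by fun_prop (disch := exact hne))

/-- Both sides come from the contour integral of `f((u + u⁻¹)/2) u^(-k-1)`, over `|u| = ρ` and over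
`|u| = 1`; Cauchy's theorem on the annulus equates the two. -/
lemma fcoeff_outer (hf : BoundedOnEllipse f ρ M) (hρ : 1 < ρ) (k : ℤ) :
    fcoeff (fun t => f ((ρ * expI 1 t + (ρ * expI 1 t)⁻¹) / 2)) k
      = (ρ : ℂ) ^ k * fcoeff (fun t => f (Real.cos t)) k := by
  have hpi : (Real.pi : ℂ) ≠ 0 := by exact_mod_cast Real.pi_ne_zero
  have hρ' : (ρ : ℂ) ≠ 0 := by exact_mod_cast (by linarith : ρ ≠ 0)
  have hd : ∀ u : ℂ, 1 ≤ ‖u‖ → ‖u‖ ≤ ρ →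
      DifferentiableAt ℂ (fun u => f ((u + u⁻¹) / 2) * u ^ (-k - 1)) u := by
    intro u h1 h2
    have hu : u ≠ 0 := by rintro rfl; norm_num at h1
    have h3 := (hf u ((inv_le_one_of_one_le₀ hρ.le).trans h1) h2).1
    have hj : DifferentiableAt ℂ (fun u : ℂ => (u + u⁻¹) / 2) u := by fun_prop (disch := exact hu)
    exact (DifferentiableAt.comp u h3 hj).mul (differentiableAt_zpow.mpr (Or.inl hu))
  have h := Complex.circleIntegral_eq_of_differentiable_on_annulus_off_countable (c := 0)
    one_pos hρ.le Set.countable_empty (f := fun u => f ((u + u⁻¹) / 2) * u ^ (-k - 1))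
    (fun u hu => by
      simp only [Set.mem_sdiff, Metric.mem_closedBall, Metric.mem_ball, dist_zero_right, not_lt] at hu
      exact (hd u hu.2 hu.1).continuousAt.continuousWithinAt)
    (fun u hu => by
      simp only [Set.mem_sdiff, Metric.mem_closedBall, Metric.mem_ball, dist_zero_right, not_le] at hu
      exact hd u hu.1.2.le hu.1.1.le)
  rw [circleIntegral_mul_zpow (by linarith) k (F := fun u => f ((u + u⁻¹) / 2)),
    circleIntegral_mul_zpow one_pos k (F := fun u => f ((u + u⁻¹) / 2))] at h
  simp only [Complex.ofReal_one, one_zpow, one_mul, mul_one, joukowski_expI] at h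
  have hk : (ρ : ℂ) ^ (-k) ≠ 0 := zpow_ne_zero _ hρ'
  have hI : Complex.I * (2 * Real.pi) ≠ 0 := mul_ne_zero Complex.I_ne_zero (by simp [hpi])
  have h' : (Complex.I * (2 * Real.pi)) * ((ρ : ℂ) ^ (-k) *
      fcoeff (fun t => f ((ρ * expI 1 t + (ρ * expI 1 t)⁻¹) / 2)) k)
      = (Complex.I * (2 * Real.pi)) * fcoeff (fun t => f (Real.cos t)) k := by
    rw [← h]; ring
  rw [← mul_left_cancel₀ hI h', zpow_neg, mul_inv_cancel_left₀ (zpow_ne_zero _ hρ')]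

lemma fcoeff_neg (k : ℤ) :
    fcoeff (fun t => f (Real.cos t)) (-k) = fcoeff (fun t => f (Real.cos t)) k :=
  fcoeff_neg_of_even (fun t => by simp) (fun t => by simp) k

lemma norm_fcoeff_le (hf : BoundedOnEllipse f ρ M) (hρ : 1 < ρ) (k : ℤ) :
    ‖fcoeff (fun t => f (Real.cos t)) k‖ ≤ M * ρ⁻¹ ^ k.natAbs := by
  have hnat : ∀ j : ℕ, ‖fcoeff (fun t => f (Real.cos t)) j‖ ≤ M * ρ⁻¹ ^ j := by
    intro j
    have h := CQ.norm_fcoeff_le (fun t => (hf.at_outer hρ t).2) j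
    have hpos : 0 < ρ ^ j := by have : 0 < ρ := by linarith
                                positivity
    rw [hf.fcoeff_outer hρ, norm_mul, zpow_natCast, norm_pow, Complex.norm_real,
      Real.norm_of_nonneg (by linarith), mul_comm] at h
    rw [inv_pow, ← div_eq_mul_inv, le_div_iff₀ hpos]
    exact h
  rcases Int.natAbs_eq k with h | h
  · have := hnat k.natAbs
    rwa [← h] at this
  · have := hnat k.natAbs
    rw [← fcoeff_neg, ← h] at this
    exact this

end BoundedOnEllipse

lemma summable_pow_natAbs {s : ℝ} (h0 : 0 < s) (h1 : s < 1) :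
    Summable fun k : ℤ => s ^ k.natAbs := by
  have h := (hasSum_poisson h0 h1 0).summable
  simp only [show ∀ k, expI k 0 = 1 from fun k => by simp [expI], mul_one] at h
  exact_mod_cast h

/-! ### The error of Gauss-Legendre quadrature for analytic functions -/

section GaussErrorStd

variable {E : Type*} [NormedAddCommGroup E] [NormedSpace ℝ E]

lemma gaussRule_neg_one_one (Q : ℕ) (f : ℝ → E) :
    gaussRule Q (-1) 1 f = ∑ y ∈ gaussNodes Q, gaussWeight Q y • f y := by
  have : ((1 : ℝ) - -1) / 2 = 1 := by norm_num
  simp only [gaussRule, this, one_smul, one_mul, neg_add_cancel_comm_assoc]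

lemma gaussError_congr {Q : ℕ} {f g : ℝ → E} (h : ∀ x ∈ Set.Icc (-1 : ℝ) 1, f x = g x) :
    gaussError Q (-1) 1 f = gaussError Q (-1) 1 g := by
  rw [gaussError, gaussError, gaussRule_neg_one_one, gaussRule_neg_one_one]
  congr 1
  · refine intervalIntegral.integral_congr fun x hx => h x ?_
    rwa [Set.uIcc_of_le (by norm_num)] at hx
  · refine Finset.sum_congr rfl fun y hy => ?_
    rw [h y (Set.Ioo_subset_Icc_self (mem_Ioo_of_mem_gaussNodes hy))]

lemma gaussError_add {Q : ℕ} {f g : ℝ → E} (hf : ContinuousOn f (Set.Icc (-1) 1))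
    (hg : ContinuousOn g (Set.Icc (-1) 1)) :
    gaussError Q (-1) 1 (fun x => f x + g x)
      = gaussError Q (-1) 1 f + gaussError Q (-1) 1 g := by
  have hle : (-1 : ℝ) ≤ 1 := by norm_num
  simp only [gaussError, gaussRule_neg_one_one, smul_add, Finset.sum_add_distrib]
  rw [intervalIntegral.integral_add (hf.intervalIntegrable_of_Icc hle)
    (hg.intervalIntegrable_of_Icc hle)]
  abel

lemma norm_gaussError_le_four_mul {Q : ℕ} (hQ : 1 ≤ Q) {f : ℝ → E} {M : ℝ}
    (hM : ∀ x ∈ Set.Icc (-1 : ℝ) 1, ‖f x‖ ≤ M) : ‖gaussError Q (-1) 1 f‖ ≤ 4 * M := by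
  have h1 : ‖∫ x in (-1 : ℝ)..1, f x‖ ≤ M * |1 - (-1)| :=
    intervalIntegral.norm_integral_le_of_norm_le_const fun x hx => by
      rw [Set.uIoc_of_le (by norm_num)] at hx
      exact hM x (Set.Ioc_subset_Icc_self hx)
  have h2 : ‖∑ y ∈ gaussNodes Q, gaussWeight Q y • f y‖ ≤ 2 * M := by
    rw [← sum_gaussWeight hQ, Finset.sum_mul]
    refine norm_sum_le_of_le _ fun y hy => ?_
    rw [norm_smul, Real.norm_of_nonneg (gaussWeight_nonneg hy)]
    exact mul_le_mul_of_nonneg_left (hM y (Set.Ioo_subset_Icc_self (mem_Ioo_of_mem_gaussNodes hy)))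
      (gaussWeight_nonneg hy)
  rw [gaussError, gaussRule_neg_one_one]
  refine (norm_sub_le _ _).trans ?_
  norm_num at h1
  linarith

end GaussErrorStd

lemma gaussError_chebyshev {Q : ℕ} (s : Finset ℤ) (hs : ∀ k ∈ s, k.natAbs < 2 * Q) (d : ℤ → ℂ) :
    gaussError Q (-1) 1
      (fun x => ∑ k ∈ s, d k * (((Polynomial.Chebyshev.T ℝ k).eval x : ℝ) : ℂ)) = 0 := by
  have hT : ∀ k ∈ s, ∫ x in (-1 : ℝ)..1, (((Polynomial.Chebyshev.T ℝ k).eval x : ℝ) : ℂ)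
      = ∑ y ∈ gaussNodes Q, (gaussWeight Q y : ℂ)
        * (((Polynomial.Chebyshev.T ℝ k).eval y : ℝ) : ℂ) := by
    intro k hk
    rw [intervalIntegral.integral_ofReal,
      integral_eq_gauss _ (by rw [Polynomial.Chebyshev.natDegree_T]; exact hs k hk)]
    push_cast
    rfl
  rw [gaussError, gaussRule_neg_one_one, intervalIntegral.integral_finsetSum, sub_eq_zero]
  · simp only [Finset.smul_sum]
    rw [Finset.sum_comm]
    refine Finset.sum_congr rfl fun k hk => ?_
    rw [intervalIntegral.integral_const_mul, hT k hk, Finset.mul_sum]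
    refine Finset.sum_congr rfl fun y _ => ?_
    rw [Complex.real_smul]
    ring
  · intro k _
    exact Continuous.intervalIntegrable
      (continuous_const.mul (Complex.continuous_ofReal.comp (Polynomial.continuous _))) _ _

/-! ### Polynomial approximation of functions analytic in a Bernstein ellipse -/

lemma hasSum_two_mul_cos {a : ℤ → ℂ} {A : ℝ → ℂ}
    (h : ∀ θ, HasSum (fun k => a k * expI k θ) (A θ)) (θ : ℝ) :
    HasSum (fun k => a k * (2 * Complex.cos (k * θ))) (A θ + A (-θ)) := by
  refine ((h θ).add (h (-θ))).congr_fun fun k => ?_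
  rw [← expI_add_expI_neg, mul_add]

lemma hasSum_two_mul_cos_neg {a : ℤ → ℂ} {A : ℝ → ℂ}
    (h : ∀ θ, HasSum (fun k => a k * expI k θ) (A θ)) (θ : ℝ) :
    HasSum (fun k => a (-k) * (2 * Complex.cos (k * θ))) (A θ + A (-θ)) := by
  have h1 := (Equiv.neg ℤ).hasSum_iff.mpr (hasSum_two_mul_cos h θ)
  refine h1.congr_fun fun k => ?_
  simp only [Function.comp, Equiv.neg_apply]
  push_cast
  rw [neg_mul, Complex.cos_neg]

/-- The multiplier whose kernel is `s^N P_s - s^(5N) P_(s^3)`, where `P_r` is the Poisson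
kernel. -/
noncomputable def gaussMult (s : ℝ) (N : ℕ) (k : ℤ) : ℝ :=
  s ^ N * s ^ k.natAbs - s ^ (5 * N) * (s ^ 3) ^ k.natAbs

/-- Multiplying the coefficients on the ellipse, `s^(-k) F k`, by the shifted multiplier and
symmetrizing in `k` reproduces `F k` for `|k| ≥ N`, up to `s^(8N) s^(4|k|)`. With `|k| = N + j` the
first two terms are `1 - s^(4N+2j)` and `s^(4N+2j) - s^(12N+4j)`: the second Poisson kernel is there
to cancel `s^(4N+2j)`. -/
lemma gaussMult_add {s : ℝ} (h0 : 0 < s) {N : ℕ} {k : ℤ} (hk : N ≤ k.natAbs) :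
    gaussMult s N (k - N) * s⁻¹ ^ k + gaussMult s N (-k - N) * s⁻¹ ^ (-k)
      + s ^ (8 * N) * (s ^ 4) ^ k.natAbs = 1 := by
  obtain ⟨j, hj⟩ := Nat.exists_eq_add_of_le hk
  have hpos : ∀ i : ℕ, s⁻¹ ^ (-(i : ℤ)) = s ^ i := fun i => by
    rw [inv_zpow', neg_neg, zpow_natCast]
  have hneg : ∀ i : ℕ, s⁻¹ ^ (i : ℤ) = (s ^ i)⁻¹ := fun i => by rw [zpow_natCast, inv_pow]
  have key : gaussMult s N j * (s ^ (N + j))⁻¹ + gaussMult s N (-((N + j : ℕ) : ℤ) - N) * s ^ (N + j)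
      + s ^ (8 * N) * (s ^ 4) ^ (N + j) = 1 := by
    have h1 : (-((N + j : ℕ) : ℤ) - N).natAbs = 2 * N + j := by omega
    have h2 : (j : ℤ).natAbs = j := Int.natAbs_natCast j
    have hp : (s ^ (N + j)) ≠ 0 := by positivity
    rw [gaussMult, gaussMult, h1, h2]
    field_simp
    ring
  rcases Int.natAbs_eq k with h | h
  · rw [h, Int.natAbs_natCast, hj, hpos, hneg]
    have e : ((N + j : ℕ) : ℤ) - N = j := by push_cast; ring
    rw [e]
    exact key
  · rw [h, Int.natAbs_neg, Int.natAbs_natCast, neg_neg, hj, hpos, hneg]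
    have e : ((N + j : ℕ) : ℤ) - N = j := by push_cast; ring
    rw [e]
    linarith [key]

lemma hasSum_gaussMult {s : ℝ} (h0 : 0 < s) (h1 : s < 1) (N : ℕ) (τ : ℝ) :
    HasSum (fun k => (gaussMult s N k : ℂ) * expI k τ)
      ((s ^ N * poisson s τ - s ^ (5 * N) * poisson (s ^ 3) τ : ℝ) : ℂ) := by
  have hA := (hasSum_poisson h0 h1 τ).mul_left ((s ^ N : ℝ) : ℂ)
  have hB := (hasSum_poisson (pow_pos h0 3) (pow_lt_one₀ h0.le h1 (by norm_num)) τ).mul_left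
    ((s ^ (5 * N) : ℝ) : ℂ)
  have h := hA.sub hB
  simp only [← Complex.ofReal_mul, ← Complex.ofReal_sub] at h
  refine h.congr_fun fun k => ?_
  rw [gaussMult]
  push_cast
  ring

lemma summable_gaussMult {s : ℝ} (h0 : 0 < s) (h1 : s < 1) (N : ℕ) : Summable (gaussMult s N) :=
  ((summable_pow_natAbs h0 h1).mul_left _).sub
    ((summable_pow_natAbs (pow_pos h0 3) (pow_lt_one₀ h0.le h1 (by norm_num))).mul_left _)

lemma continuous_tsum_expI {a : ℤ → ℂ} (ha : Summable fun k => ‖a k‖) :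
    Continuous fun θ => ∑' k, a k * expI k θ :=
  continuous_tsum (fun k => continuous_const.mul (continuous_expI k)) ha
    fun k θ => by rw [norm_mul, norm_expI, mul_one]

lemma summable_mul_expI {a : ℤ → ℂ} (ha : Summable fun k => ‖a k‖) (θ : ℝ) :
    Summable fun k => a k * expI k θ :=
  Summable.of_norm (by simpa only [norm_mul, norm_expI, mul_one] using ha)

/-- A function that is analytic and bounded by `M` in the Bernstein ellipse with parameter `ρ` is,
on `[-1, 1]`, the sum of a polynomial of degree less than `N` and of a continuous function bounded
by `2 * M * ρ ^ (-N)`. -/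
lemma BoundedOnEllipse.exists_eq_chebyshev_add {f : ℂ → ℂ} {ρ M : ℝ} (hf : BoundedOnEllipse f ρ M)
    (hρ : 1 < ρ) {N : ℕ} (hN : ρ⁻¹ ^ N ≤ 1 / 2) :
    ∃ (d : ℤ → ℂ) (G : ℝ → ℂ), Continuous G ∧ (∀ x, ‖G x‖ ≤ 2 * M * ρ⁻¹ ^ N) ∧
      ∀ x ∈ Set.Icc (-1 : ℝ) 1, f x
        = ∑ k ∈ Finset.Ioo (-N : ℤ) N, d k * (((Polynomial.Chebyshev.T ℝ k).eval x : ℝ) : ℂ)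
          + G x := by
  set s := ρ⁻¹ with hs
  have h0 : 0 < s := inv_pos.mpr (by linarith)
  have h1 : s < 1 := inv_lt_one_of_one_lt₀ hρ
  have hsρ : s⁻¹ = ρ := inv_inv ρ
  have hM0 : 0 ≤ M := (norm_nonneg _).trans (hf.at_cos hρ 0).2
  have h04 : 0 < s ^ 4 := by positivity
  have h14 : s ^ 4 < 1 := pow_lt_one₀ h0.le h1 (by norm_num)
  have hN0 : 0 < s ^ N := by positivity
  set φ : ℝ → ℂ := fun t => f (Real.cos t) with hφ
  set h : ℝ → ℂ := fun t => f ((ρ * expI 1 t + (ρ * expI 1 t)⁻¹) / 2) with hh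
  set F := fcoeff φ with hF
  have hFn : ∀ k, ‖F k‖ ≤ M * s ^ k.natAbs := hf.norm_fcoeff_le hρ
  have hFs : Summable fun k => ‖F k‖ :=
    Summable.of_nonneg_of_le (fun _ => norm_nonneg _) hFn ((summable_pow_natAbs h0 h1).mul_left M)
  set b : ℤ → ℂ := fun k => (gaussMult s N (k - N) : ℂ) * fcoeff h k with hb
  -- `k - 0` keeps the shape of `norm_multiplier_le` with `n = 0`.
  set g : ℤ → ℂ := fun k => (((s ^ 4) ^ (k - 0).natAbs : ℝ) : ℂ) * F k with hg
  have hbs : Summable fun k => ‖b k‖ := by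
    refine Summable.of_nonneg_of_le (fun _ => norm_nonneg _) (fun k => ?_)
      (((Equiv.subRight (N : ℤ)).summable_iff.mpr (summable_gaussMult h0 h1 N).abs).mul_right M)
    rw [hb, norm_mul, Complex.norm_real, Real.norm_eq_abs]
    exact mul_le_mul_of_nonneg_left (CQ.norm_fcoeff_le (fun t => (hf.at_outer hρ t).2) k)
      (abs_nonneg _)
  have hgs : Summable fun k => ‖g k‖ := by
    refine Summable.of_nonneg_of_le (fun _ => norm_nonneg _) (fun k => ?_) hFs
    rw [hg, norm_mul, Complex.norm_real, Real.norm_of_nonneg (by positivity)]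
    exact mul_le_of_le_one_left (norm_nonneg _) (pow_le_one₀ h04.le h14.le)
  set B : ℝ → ℂ := fun θ => ∑' k, b k * expI k θ with hB
  set P : ℝ → ℂ := fun θ => ∑' k, g k * expI k θ with hP
  have hBn : ∀ θ, ‖B θ‖ ≤ M * (s ^ N - s ^ (5 * N)) := by
    intro θ
    have := norm_multiplier_le (summable_gaussMult h0 h1 N)
      (w := fun τ => s ^ N * poisson s τ - s ^ (5 * N) * poisson (s ^ 3) τ)
      (((continuous_poisson h0 h1).const_mul _).sub ((continuous_poisson (pow_pos h0 3)
        (pow_lt_one₀ h0.le h1 (by norm_num))).const_mul _))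
      (fun τ => by
        have e1 := poisson_cube_le h0 h1 τ
        have e2 := poisson_nonneg h0 h1 τ
        -- Nonnegativity of the kernel needs `3 s^(4N) ≤ 1`; this is where `s^N ≤ 1/2` enters.
        have e3 : 3 * s ^ (5 * N) ≤ s ^ N := by
          have : s ^ (5 * N) = s ^ N * (s ^ N) ^ 4 := by ring
          have h4 : (s ^ N) ^ 4 ≤ (1 / 2) ^ 4 := pow_le_pow_left₀ hN0.le hN 4
          rw [this]
          nlinarith
        have e4 : 0 ≤ s ^ (5 * N) := by positivity
        nlinarith [mul_le_mul_of_nonneg_left e1 e4, mul_le_mul_of_nonneg_right e3 e2])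
      (hasSum_gaussMult h0 h1 N) (hf.continuous_outer hρ) (fun t => (hf.at_outer hρ t).2) N θ
    have e0 : gaussMult s N 0 = s ^ N - s ^ (5 * N) := by simp [gaussMult]
    rw [← e0]
    exact this
  have hPn : ∀ θ, ‖P θ‖ ≤ M := by
    intro θ
    have := norm_multiplier_le (summable_pow_natAbs h04 h14) (continuous_poisson h04 h14)
      (poisson_nonneg h04 h14) (hasSum_poisson h04 h14) (hf.continuous_comp_cos hρ)
      (fun t => (hf.at_cos hρ t).2) 0 θ
    rw [Int.natAbs_zero, pow_zero, mul_one] at this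
    exact this
  have hBc : Continuous B := continuous_tsum_expI hbs
  have hPc : Continuous P := continuous_tsum_expI hgs
  -- What is left of `F` after removing the symmetrized multiplier and the remainder. By
  -- `gaussMult_add` it vanishes for `|k| ≥ N`, so it is the coefficient sequence of a polynomial.
  set d : ℤ → ℂ := fun k => F k - (b k + b (-k)) - s ^ (8 * N) * g k with hd
  have hd0 : ∀ k, k ∉ Finset.Ioo (-N : ℤ) N → d k = 0 := by
    intro k hk
    have hk' : N ≤ k.natAbs := by
      by_contra! hlt
      exact hk (Finset.mem_Ioo.mpr (by omega))
    have e := gaussMult_add h0 hk'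
    rw [hsρ] at e
    have e' : ((gaussMult s N (k - N) : ℝ) : ℂ) * (ρ : ℂ) ^ k
        + ((gaussMult s N (-k - N) : ℝ) : ℂ) * (ρ : ℂ) ^ (-k)
        + (s : ℂ) ^ (8 * N) * ((s : ℂ) ^ 4) ^ k.natAbs = 1 := by exact_mod_cast e
    have eb : ∀ k, b k = (gaussMult s N (k - N) : ℂ) * ((ρ : ℂ) ^ k * F k) := fun k => by
      rw [hb, ← hf.fcoeff_outer hρ]
    have eF : F (-k) = F k := BoundedOnEllipse.fcoeff_neg k
    simp only [hd]
    rw [eb, eb, eF, hg]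
    simp only [sub_zero]
    push_cast
    linear_combination (-F k) * e'
  refine ⟨d, fun x => (B (Real.arccos x) + B (-Real.arccos x))
    + s ^ (8 * N) * ((P (Real.arccos x) + P (-Real.arccos x)) / 2), ?_, fun x => ?_,
    fun x hx => ?_⟩
  · have := Real.continuous_arccos
    fun_prop
  · set t := Real.arccos x
    have e1 : ‖B t + B (-t)‖ ≤ 2 * (M * (s ^ N - s ^ (5 * N))) := by
      refine (norm_add_le _ _).trans ?_
      linarith [hBn t, hBn (-t)]
    have e2 : ‖(P t + P (-t)) / 2‖ ≤ M := by
      rw [norm_div, Complex.norm_ofNat]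
      have := (norm_add_le (P t) (P (-t)))
      linarith [hPn t, hPn (-t)]
    have e3 : ‖(s : ℂ) ^ (8 * N) * ((P t + P (-t)) / 2)‖ ≤ s ^ (8 * N) * M := by
      rw [norm_mul, norm_pow, Complex.norm_real, Real.norm_of_nonneg h0.le]
      gcongr
    refine (norm_add_le _ _).trans ?_
    -- The remainder `M s^(8N)` is absorbed by the saving `-2 M s^(5N)` in the bound for `B t + B
    -- (-t)`.
    have e4 : s ^ (8 * N) ≤ s ^ (5 * N) := pow_le_pow_of_le_one h0.le h1.le (by omega)
    have e5 : 0 ≤ s ^ (5 * N) := by positivity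
    nlinarith [mul_le_mul_of_nonneg_left e4 hM0, mul_nonneg hM0 e5]
  · set t := Real.arccos x with ht
    have hcos : Real.cos t = x := Real.cos_arccos hx.1 hx.2
    have S0 := hasSum_two_mul_cos (hasSum_fcoeff (hf.continuous_comp_cos hρ)
      (fun t => by simp) hFs.of_norm) t
    have S1 := hasSum_two_mul_cos (fun θ => (summable_mul_expI hbs θ).hasSum) t
    have S2 := hasSum_two_mul_cos_neg (fun θ => (summable_mul_expI hbs θ).hasSum) t
    have S3 := hasSum_two_mul_cos (fun θ => (summable_mul_expI hgs θ).hasSum) t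
    have S := (S0.sub (S1.add S2)).sub (S3.mul_left ((s : ℂ) ^ (8 * N)))
    have S' : HasSum (fun k : ℤ => d k * (2 * Complex.cos (k * t))) _ :=
      S.congr_fun fun k => by simp only [hd]; ring
    have S'' := hasSum_sum_of_ne_finset_zero (f := fun k : ℤ => d k * (2 * Complex.cos (k * t)))
      (s := Finset.Ioo (-N : ℤ) N) (L := SummationFilter.unconditional ℤ)
      (fun k hk => by rw [hd0 k hk, zero_mul])
    have hfin := S'.unique S''
    have hT : ∀ k : ℤ, (((Polynomial.Chebyshev.T ℝ k).eval x : ℝ) : ℂ) = Complex.cos (k * t) := by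
      intro k
      rw [← hcos, Polynomial.Chebyshev.T_real_cos]
      push_cast
      rfl
    simp only [hT]
    have hx2 : f x + f x - ((B t + B (-t)) + (B t + B (-t))) - s ^ (8 * N) * (P t + P (-t))
        = 2 * ∑ k ∈ Finset.Ioo (-N : ℤ) N, d k * Complex.cos (k * t) := by
      rw [Finset.mul_sum]
      rw [Real.cos_neg, hcos] at hfin
      rw [hfin]
      exact Finset.sum_congr rfl fun k _ => by ring
    linear_combination hx2 / 2

/-- The error of `Q`-point Gauss-Legendre quadrature on `[-1, 1]` for a function that is analytic
and bounded by `M` in the Bernstein ellipse with parameter `ρ`. -/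
theorem norm_gaussError_le {f : ℂ → ℂ} {ρ M : ℝ} (hf : BoundedOnEllipse f ρ M) (hρ : 1 < ρ)
    {Q : ℕ} (hQ : 1 ≤ Q) :
    ‖gaussError Q (-1) 1 (fun x : ℝ => f x)‖ ≤ 8 * M * ρ⁻¹ ^ (2 * Q) := by
  have hM0 : 0 ≤ M := (norm_nonneg _).trans (hf.at_cos hρ 0).2
  rcases le_or_gt (ρ⁻¹ ^ (2 * Q)) (1 / 2) with hN | hN
  · obtain ⟨d, G, hGc, hGn, hfG⟩ := hf.exists_eq_chebyshev_add hρ hN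
    rw [gaussError_congr hfG, gaussError_add, gaussError_chebyshev, zero_add]
    · exact (norm_gaussError_le_four_mul hQ fun x _ => hGn x).trans (le_of_eq (by ring))
    · intro k hk
      have := Finset.mem_Ioo.mp hk
      push_cast at this
      omega
    · exact Continuous.continuousOn (continuous_finsetSum _ fun k _ =>
        continuous_const.mul (Complex.continuous_ofReal.comp (Polynomial.continuous _)))
    · exact hGc.continuousOn
  -- Here `ρ^(-2Q) > 1/2`, and the trivial bound `4 M` is already enough.
  · have := norm_gaussError_le_four_mul hQ (f := fun x : ℝ => f x) (M := M) fun x hx => by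
      have := (hf.at_cos hρ (Real.arccos x)).2
      rwa [Real.cos_arccos hx.1 hx.2] at this
    nlinarith

/-! ### Runge-Kutta convolution quadrature weights -/

section ShermanMorrison

variable {n K : Type*} [Fintype n] [DecidableEq n] [CommRing K]

/-- The Sherman-Morrison formula over a commutative ring. The equation `hψ` states `ψ = ω / (1 - ω
(r - 1))` without division; for `ω = ζ / (1 - ζ)` this is `ψ = ζ / (1 - rζ)`. -/
lemma one_sub_smul_mul_resolvent {A R : Matrix n n K} {z ω ψ r : K} {u b : n → K}
    (hR : (1 - z • A) * R = 1) (hr : r = 1 + z * (b ⬝ᵥ (R *ᵥ u)))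
    (hψ : ψ = ω + ω * (r - 1) * ψ) :
    (1 - z • (A + ω • Matrix.vecMulVec u b)) *
      (A * R + ψ • Matrix.vecMulVec (R *ᵥ u) (b ᵥ* R)) = A + ω • Matrix.vecMulVec u b := by
  have hcomm : (1 - z • A) * (A * R) = A := by
    rw [← mul_assoc, sub_mul, one_mul, smul_mul_assoc, ← mul_smul_comm, ← mul_one_sub, mul_assoc,
      hR, mul_one]
  have hzAR : z • (A * R) = R - 1 := by
    rw [sub_mul, one_mul, smul_mul_assoc] at hR
    rw [← hR]; abel
  have hv : (1 - z • A) * Matrix.vecMulVec (R *ᵥ u) (b ᵥ* R) = Matrix.vecMulVec u (b ᵥ* R) := by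
    rw [Matrix.mul_vecMulVec, Matrix.mulVec_mulVec, hR, Matrix.one_mulVec]
  have hw : z • (Matrix.vecMulVec u b * (A * R))
      = Matrix.vecMulVec u (b ᵥ* R) - Matrix.vecMulVec u b := by
    rw [← mul_smul_comm, hzAR, mul_sub, mul_one, Matrix.vecMulVec_mul]
  have hx : z • (Matrix.vecMulVec u b * Matrix.vecMulVec (R *ᵥ u) (b ᵥ* R))
      = (r - 1) • Matrix.vecMulVec u (b ᵥ* R) := by
    rw [Matrix.vecMulVec_mul_vecMulVec, hr, Matrix.vecMulVec_smul, smul_smul, add_sub_cancel_left]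
  have hsplit : (1 - z • (A + ω • Matrix.vecMulVec u b)) *
      (A * R + ψ • Matrix.vecMulVec (R *ᵥ u) (b ᵥ* R))
      = (1 - z • A) * (A * R) + ψ • ((1 - z • A) * Matrix.vecMulVec (R *ᵥ u) (b ᵥ* R))
        - ω • (z • (Matrix.vecMulVec u b * (A * R)))
        - (ω * ψ) • (z • (Matrix.vecMulVec u b * Matrix.vecMulVec (R *ᵥ u) (b ᵥ* R))) := by
    have e : (1 - z • (A + ω • Matrix.vecMulVec u b))
        = (1 - z • A) - (ω * z) • Matrix.vecMulVec u b := by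
      rw [smul_add, smul_smul, mul_comm z ω]; abel
    rw [e, sub_mul, mul_add, mul_add, mul_smul_comm, mul_smul_comm, smul_mul_assoc,
      smul_mul_assoc, smul_smul, smul_smul, smul_smul]
    have : ψ * (ω * z) = ω * ψ * z := by ring
    rw [this]; abel
  rw [hsplit, hcomm, hv, hw, hx]
  ext i j
  simp only [Matrix.add_apply, Matrix.sub_apply, Matrix.smul_apply, smul_eq_mul]
  linear_combination Matrix.vecMulVec u (b ᵥ* R) i j * hψ

end ShermanMorrison

lemma mk_pow_mul_one_sub (r : ℂ) :
    (PowerSeries.mk fun n => r ^ n) * (1 - PowerSeries.C r * PowerSeries.X) = 1 := by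
  ext n
  rw [mul_sub, mul_one, ← mul_assoc, map_sub, PowerSeries.coeff_mk]
  cases n with
  | zero => simp
  | succ n =>
    rw [PowerSeries.coeff_succ_mul_X, mul_comm, PowerSeries.coeff_C_mul, PowerSeries.coeff_mk,
      PowerSeries.coeff_one]
    simp [pow_succ']

namespace RungeKutta

variable {m : ℕ} (M : RungeKutta m)

/-- The resolvent `(I - z A)⁻¹`. -/
noncomputable def R (z : ℂ) : Matrix (Fin (m + 1)) (Fin (m + 1)) ℂ := (1 - z • M.Ac)⁻¹

variable {M}

lemma one_sub_mul_R {z : ℂ} (hz : (1 - z • M.Ac).det ≠ 0) : (1 - z • M.Ac) * M.R z = 1 :=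
  Matrix.mul_nonsing_inv _ (isUnit_iff_ne_zero.mpr hz)

lemma R_mul_one_sub {z : ℂ} (hz : (1 - z • M.Ac).det ≠ 0) : M.R z * (1 - z • M.Ac) = 1 :=
  Matrix.nonsing_inv_mul _ (isUnit_iff_ne_zero.mpr hz)

lemma det_Ac_ne_zero (hA : M.A.det ≠ 0) : M.Ac.det ≠ 0 := by
  have : M.Ac.det = (M.A.det : ℂ) := (Complex.ofRealHom.map_det M.A).symm
  rw [this]
  exact_mod_cast hA

lemma q_eq (z : ℂ) : M.q z = M.bc ᵥ* M.R z := rfl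

lemma r_eq (z : ℂ) : M.r z = 1 + z * (M.bc ⬝ᵥ (M.R z *ᵥ 1)) := rfl

lemma Ac_last (hs : M.StifflyAccurate) : M.Ac (Fin.last m) = M.bc := by
  funext j
  rw [Ac, Matrix.map_apply, hs j, bc]

lemma r_eq_last (hs : M.StifflyAccurate) {z : ℂ} (hz : (1 - z • M.Ac).det ≠ 0) :
    M.r z = (M.R z *ᵥ 1) (Fin.last m) := by
  have h : M.R z = 1 + z • (M.Ac * M.R z) := by
    have := one_sub_mul_R hz
    rw [sub_mul, one_mul, smul_mul_assoc] at this
    rw [← this]; abel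
  rw [r_eq]
  conv_rhs => rw [h]
  rw [Matrix.add_mulVec, Matrix.one_mulVec, Matrix.smul_mulVec, Pi.add_apply, Pi.smul_apply,
    ← Matrix.mulVec_mulVec, Matrix.mulVec, Ac_last hs, Pi.one_apply, smul_eq_mul]

lemma q_eq_last (hs : M.StifflyAccurate) (z : ℂ) : M.q z = (M.Ac * M.R z) (Fin.last m) := by
  rw [Matrix.mul_apply_eq_vecMul, Ac_last hs, q_eq]

lemma symbol_resolvent (hA : M.A.det ≠ 0) {z : ℂ} (hz : (1 - z • M.Ac).det ≠ 0) :
    (M.symbol - (PowerSeries.C z : ℂ⟦X⟧) • 1)⁻¹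
      = (M.Ac * M.R z).map (PowerSeries.C (R := ℂ))
        + ((PowerSeries.X : ℂ⟦X⟧) * PowerSeries.mk fun n => M.r z ^ n) •
          (Matrix.vecMulVec (M.R z *ᵥ 1) (M.q z)).map (PowerSeries.C (R := ℂ)) := by
  set C : ℂ →+* ℂ⟦X⟧ := PowerSeries.C with hC
  set ω : ℂ⟦X⟧ := PowerSeries.X * (1 - PowerSeries.X)⁻¹ with hω
  set ψ : ℂ⟦X⟧ := PowerSeries.X * PowerSeries.mk fun n => M.r z ^ n with hψ
  have hvec : ∀ v w : Fin (m + 1) → ℂ, (Matrix.vecMulVec v w).map C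
      = Matrix.vecMulVec (fun i => C (v i)) (fun i => C (w i)) := fun v w => by
    ext1 i j; simp [Matrix.vecMulVec_apply]
  have h1 : (fun i : Fin (m + 1) => C ((1 : Fin (m + 1) → ℂ) i)) = 1 := by
    funext i; simp
  have hRu : (fun i => C ((M.R z *ᵥ 1) i)) = (M.R z).map C *ᵥ 1 := by
    funext i
    rw [RingHom.map_mulVec]
    congr 1
  have hbR : (fun i => C (M.q z i)) = (fun i => C (M.bc i)) ᵥ* (M.R z).map C := by
    funext i
    rw [q_eq, RingHom.map_vecMul]
    rfl
  have hR : (1 - C z • M.Ac.map C) * (M.R z).map C = 1 := by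
    have h := congrArg (fun X => X.map C) (one_sub_mul_R hz)
    simp only [Matrix.map_mul] at h
    rw [Matrix.map_one _ (map_zero C) (map_one C)] at h
    refine Eq.trans ?_ h
    congr 1
    ext1 i j
    simp [Matrix.one_apply, apply_ite C]
  have hr : C (M.r z) = 1 + C z * ((fun i => C (M.bc i)) ⬝ᵥ ((M.R z).map C *ᵥ 1)) := by
    rw [r_eq, map_add, map_one, map_mul, ← hRu, RingHom.map_dotProduct]
    rfl
  have hv : (1 - PowerSeries.X : ℂ⟦X⟧) * (1 - PowerSeries.X)⁻¹ = 1 :=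
    PowerSeries.mul_inv_cancel _ (by simp)
  have hψ' : ψ = ω + ω * (C (M.r z) - 1) * ψ := by
    have hg := mk_pow_mul_one_sub (M.r z)
    rw [hω]
    have hg' : ψ * (1 - C (M.r z) * PowerSeries.X) = PowerSeries.X := by
      rw [hψ, mul_assoc, hg, mul_one]
    linear_combination (1 - PowerSeries.X : ℂ⟦X⟧)⁻¹ * hg' - ψ * hv
  have key := one_sub_smul_mul_resolvent (A := M.Ac.map C) (u := 1) hR hr hψ'
  set P := M.Ac.map C + ω • Matrix.vecMulVec 1 (fun i => C (M.bc i)) with hP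
  -- A power series is a unit when its constant term is; here that term is `det A`.
  have hPdet : IsUnit P.det := by
    rw [PowerSeries.isUnit_iff_constantCoeff, RingHom.map_det]
    have : (PowerSeries.constantCoeff (R := ℂ)).mapMatrix P = M.Ac := by
      ext i j
      simp [hP, hω, hC]
    rw [this]
    exact isUnit_iff_ne_zero.mpr (det_Ac_ne_zero hA)
  have hsym : M.symbol = P⁻¹ := by
    rw [symbol, hP, ← h1, ← hvec]
  rw [hsym, hvec, hRu, hbR, Matrix.map_mul]
  refine Matrix.inv_eq_right_inv ?_
  have hfac : P⁻¹ - C z • 1 = P⁻¹ * (1 - C z • P) := by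
    rw [mul_sub, mul_one, mul_smul_comm, Matrix.nonsing_inv_mul _ hPdet]
  rw [hfac, mul_assoc, key, Matrix.nonsing_inv_mul _ hPdet]

lemma E_zero (hA : M.A.det ≠ 0) {z : ℂ} (hz : (1 - z • M.Ac).det ≠ 0) :
    M.E 0 z = M.Ac * M.R z := by
  rw [E, symbol_resolvent hA hz]
  ext i j
  simp only [Matrix.map_apply, Matrix.add_apply, Matrix.smul_apply, smul_eq_mul, map_add,
    PowerSeries.coeff_C, PowerSeries.coeff_mul_C, PowerSeries.coeff_zero_X_mul]
  simp

lemma E_succ (hA : M.A.det ≠ 0) {z : ℂ} (hz : (1 - z • M.Ac).det ≠ 0) (n : ℕ) :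
    M.E (n + 1) z = M.r z ^ n • Matrix.vecMulVec (M.R z *ᵥ 1) (M.q z) := by
  rw [E, symbol_resolvent hA hz]
  ext i j
  simp only [Matrix.map_apply, Matrix.add_apply, Matrix.smul_apply, smul_eq_mul, map_add,
    PowerSeries.coeff_C, PowerSeries.coeff_mul_C, PowerSeries.coeff_succ_X_mul,
    PowerSeries.coeff_mk]
  simp

lemma e_eq (hA : M.A.det ≠ 0) (hs : M.StifflyAccurate) {z : ℂ} (hz : (1 - z • M.Ac).det ≠ 0)
    (n : ℕ) : M.e n z = M.r z ^ n • M.q z := by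
  cases n with
  | zero => rw [e, E_zero hA hz, q_eq_last hs, pow_zero, one_smul]
  | succ n =>
    funext j
    rw [e, E_succ hA hz, Matrix.smul_apply, Matrix.vecMulVec_apply, ← r_eq_last hs hz,
      Pi.smul_apply, smul_eq_mul, smul_eq_mul, pow_succ, mul_assoc]

end RungeKutta

/-! ### Bounds for the resolvent of the coefficient matrix -/

section MatrixInverse

variable {ι : Type*} [Fintype ι] [DecidableEq ι] {X : ℂ → Matrix ι ι ℂ}

lemma differentiable_det (hX : ∀ i j, Differentiable ℂ fun z => X z i j) :
    Differentiable ℂ fun z => (X z).det := by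
  intro z
  simp only [Matrix.det_apply]
  exact DifferentiableAt.fun_sum fun σ _ => DifferentiableAt.const_smul
    (DifferentiableAt.fun_finsetProd fun i _ => hX _ _ z) _

lemma differentiable_adjugate (hX : ∀ i j, Differentiable ℂ fun z => X z i j) (i j : ι) :
    Differentiable ℂ fun z => (X z).adjugate i j := by
  simp only [Matrix.adjugate_apply]
  refine differentiable_det fun k l => ?_
  by_cases hk : k = j
  · subst hk
    simp only [Matrix.updateRow_self]
    exact differentiable_const _
  · simp only [Matrix.updateRow_ne hk]
    exact hX k l

lemma differentiableAt_inv_apply (hX : ∀ i j, Differentiable ℂ fun z => X z i j) {z : ℂ}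
    (hz : (X z).det ≠ 0) (i j : ι) : DifferentiableAt ℂ (fun z => (X z)⁻¹ i j) z := by
  simp only [Matrix.inv_def, Matrix.smul_apply, Ring.inverse_eq_inv', smul_eq_mul]
  exact ((differentiable_det hX z).inv hz).mul (differentiable_adjugate hX i j z)

end MatrixInverse

/-- A seminorm on vectors is bounded by a multiple of the maximum norm. -/
lemma exists_seminorm_pi_le {ι : Type*} [Fintype ι] [DecidableEq ι] (N : Seminorm ℂ (ι → ℂ)) :
    ∃ D : ℝ, 1 ≤ D ∧ ∀ (v : ι → ℂ) (a : ℝ), 0 ≤ a → (∀ i, ‖v i‖ ≤ a) → N v ≤ D * a := by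
  -- The summand 1 ensures `D ≥ 1`, so that a factor `D` can later be absorbed into `D^(n+1)`.
  refine ⟨1 + ∑ i, N (fun j => if i = j then 1 else 0), ?_, fun v a ha hv => ?_⟩
  · have : 0 ≤ ∑ i : ι, N (fun j => if i = j then 1 else 0) :=
      Finset.sum_nonneg fun i _ => apply_nonneg N _
    linarith
  · rw [pi_eq_sum_univ v]
    refine (Finset.le_sum_of_subadditive N (map_zero N).le (map_add_le_add N) _ _).trans ?_
    rw [add_mul, one_mul, Finset.sum_mul]
    refine le_trans (Finset.sum_le_sum fun i _ => ?_) (le_add_of_nonneg_left ha)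
    rw [map_smul_eq_mul, mul_comm]
    exact mul_le_mul_of_nonneg_left (hv i) (apply_nonneg N _)

/-- A seminorm on matrices is bounded by a multiple of the maximum of the moduli of the entries. -/
lemma exists_seminorm_matrix_le {ι : Type*} [Fintype ι] [DecidableEq ι]
    (N : Seminorm ℂ (Matrix ι ι ℂ)) :
    ∃ D : ℝ, 1 ≤ D ∧ ∀ (V : Matrix ι ι ℂ) (a : ℝ), 0 ≤ a → (∀ i j, ‖V i j‖ ≤ a) → N V ≤ D * a := by
  refine ⟨1 + ∑ i, ∑ j, N (Matrix.single i j 1), ?_, fun V a ha hV => ?_⟩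
  · have : 0 ≤ ∑ i, ∑ j, N (Matrix.single i j 1) :=
      Finset.sum_nonneg fun i _ => Finset.sum_nonneg fun j _ => apply_nonneg N _
    linarith
  · rw [Matrix.matrix_eq_sum_single V]
    refine (Finset.le_sum_of_subadditive N (map_zero N).le (map_add_le_add N) _ _).trans ?_
    rw [add_mul, one_mul, Finset.sum_mul]
    refine le_trans (Finset.sum_le_sum fun i _ => ?_) (le_add_of_nonneg_left ha)
    refine (Finset.le_sum_of_subadditive N (map_zero N).le (map_add_le_add N) _ _).trans ?_
    rw [Finset.sum_mul]
    refine Finset.sum_le_sum fun j _ => ?_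
    have : Matrix.single i j (V i j) = V i j • Matrix.single i j (1 : ℂ) := by
      rw [Matrix.smul_single, smul_eq_mul, mul_one]
    rw [this, map_smul_eq_mul, mul_comm]
    exact mul_le_mul_of_nonneg_left (hV i j) (apply_nonneg N _)

namespace RungeKutta

variable {m : ℕ} {M : RungeKutta m}

lemma differentiable_one_sub (i j : Fin (m + 1)) :
    Differentiable ℂ fun z : ℂ => (1 - z • M.Ac) i j := by
  simp only [Matrix.sub_apply, Matrix.smul_apply, smul_eq_mul]
  fun_prop

lemma differentiableAt_R {z : ℂ} (hz : (1 - z • M.Ac).det ≠ 0) (i j : Fin (m + 1)) :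
    DifferentiableAt ℂ (fun z => M.R z i j) z :=
  differentiableAt_inv_apply (X := fun z => 1 - z • M.Ac) differentiable_one_sub hz i j

lemma differentiableAt_q {z : ℂ} (hz : (1 - z • M.Ac).det ≠ 0) (j : Fin (m + 1)) :
    DifferentiableAt ℂ (fun z => M.q z j) z := by
  simp only [q_eq, Matrix.vecMul, dotProduct]
  exact DifferentiableAt.fun_sum fun i _ => (differentiableAt_R hz i j).const_mul _

lemma differentiableAt_r {z : ℂ} (hz : (1 - z • M.Ac).det ≠ 0) : DifferentiableAt ℂ M.r z := by
  have : M.r = fun z => 1 + z * ∑ i, M.bc i * ∑ j, M.R z i j * 1 := rfl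
  rw [this]
  refine (differentiableAt_const _).add (differentiableAt_id.mul
    (DifferentiableAt.fun_sum fun i _ => DifferentiableAt.const_mul
      (DifferentiableAt.fun_sum fun j _ => (differentiableAt_R hz i j).mul_const _) _))

/-- The poles of the stability function of an `A`-stable method have real parts bounded away from
zero. -/
lemma exists_det_ne_zero (hst : M.AStable) :
    ∃ β : ℝ, 0 < β ∧ ∀ z : ℂ, z.re ≤ β → (1 - z • M.Ac).det ≠ 0 := by
  have heval : ∀ z : ℂ, M.Ac.charpolyRev.eval z = (1 - z • M.Ac).det := by
    intro z
    rw [Matrix.charpolyRev, ← Polynomial.coe_evalRingHom, RingHom.map_det]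
    congr 1
    ext i j
    simp [Matrix.one_apply, apply_ite (Polynomial.eval z), mul_comm z]
  have hne : M.Ac.charpolyRev ≠ 0 := by
    intro h
    have := Matrix.eval_charpolyRev (M := M.Ac)
    rw [h] at this
    simp at this
  have hpos : ∀ w ∈ M.Ac.charpolyRev.roots.toFinset, 0 < w.re := by
    intro w hw
    rw [Multiset.mem_toFinset, Polynomial.mem_roots hne, Polynomial.IsRoot, heval] at hw
    by_contra! hre
    exact (hst w hre).1 hw
  have hev : ∀ᶠ β : ℝ in nhdsWithin 0 (Set.Ioi 0),
      ∀ w ∈ M.Ac.charpolyRev.roots.toFinset, β < w.re :=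
    (Finset.eventually_all _).mpr fun w hw =>
      Filter.Eventually.filter_mono nhdsWithin_le_nhds (eventually_lt_nhds (hpos w hw))
  obtain ⟨β, hβ, hβ0⟩ := (hev.and self_mem_nhdsWithin).exists
  refine ⟨β, hβ0, fun z hz h => ?_⟩
  have := hβ z (by rw [Multiset.mem_toFinset, Polynomial.mem_roots hne, Polynomial.IsRoot, heval, h])
  linarith

/-- `R(z) = z⁻¹ (z⁻¹ I - A)⁻¹`, and `(w I - A)⁻¹` is continuous at `w = 0` because `A` is
invertible. -/
lemma exists_R_bound_of_large (hA : M.A.det ≠ 0) :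
    ∃ δ K : ℝ, 0 < δ ∧ ∀ z : ℂ, δ⁻¹ < ‖z‖ → ∀ i j, ‖z‖ * ‖M.R z i j‖ ≤ K := by
  have hX : ∀ i j, Differentiable ℂ fun w : ℂ => (w • 1 - M.Ac) i j := fun i j => by
    simp only [Matrix.sub_apply, Matrix.smul_apply, smul_eq_mul]
    fun_prop
  have hdet0 : ((0 : ℂ) • (1 : Matrix (Fin (m + 1)) (Fin (m + 1)) ℂ) - M.Ac).det ≠ 0 := by
    rw [zero_smul, zero_sub, Matrix.det_neg]
    exact mul_ne_zero (pow_ne_zero _ (by norm_num)) (det_Ac_ne_zero hA)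
  set T : ℂ → Matrix (Fin (m + 1)) (Fin (m + 1)) ℂ := fun w => (w • 1 - M.Ac)⁻¹ with hT
  have hev : ∀ᶠ w in nhds (0 : ℂ), (w • 1 - M.Ac).det ≠ 0 ∧
      ∀ i j, ‖T w i j‖ < ‖T 0 i j‖ + 1 := by
    refine ((differentiable_det hX).continuous.continuousAt.eventually_ne hdet0).and ?_
    refine Filter.eventually_all.mpr fun i => Filter.eventually_all.mpr fun j => ?_
    exact (differentiableAt_inv_apply hX hdet0 i j).continuousAt.norm.eventually_lt_const
      (lt_add_one _)
  obtain ⟨δ, hδ, hδ'⟩ := Metric.eventually_nhds_iff.mp hev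
  refine ⟨δ, ∑ i, ∑ j, (‖T 0 i j‖ + 1), hδ, fun z hz i j => ?_⟩
  have hz0 : 0 < ‖z‖ := (inv_pos.mpr hδ).trans hz
  have hzne : z ≠ 0 := norm_pos_iff.mp hz0
  obtain ⟨hd, hb⟩ := hδ' (y := z⁻¹) (by
    rw [dist_zero_right, norm_inv]; exact (inv_lt_comm₀ hδ hz0).mp hz)
  have hR : M.R z = z⁻¹ • T z⁻¹ := by
    refine Matrix.inv_eq_right_inv ?_
    have : 1 - z • M.Ac = z • (z⁻¹ • (1 : Matrix (Fin (m + 1)) (Fin (m + 1)) ℂ) - M.Ac) := by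
      rw [smul_sub, smul_smul, mul_inv_cancel₀ hzne, one_smul]
    rw [this, smul_mul_assoc, mul_smul_comm, smul_smul, mul_inv_cancel₀ hzne, one_smul,
      Matrix.mul_nonsing_inv _ (isUnit_iff_ne_zero.mpr hd)]
  rw [hR, Matrix.smul_apply, norm_smul, norm_inv, mul_inv_cancel_left₀ hz0.ne']
  refine (hb i j).le.trans ?_
  have h1 : ∀ i, 0 ≤ ∑ j, (‖T 0 i j‖ + 1) := fun i => by positivity
  exact (Finset.single_le_sum (f := fun j => ‖T 0 i j‖ + 1) (fun j _ => by positivity)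
    (Finset.mem_univ j)).trans (Finset.single_le_sum (f := fun i => ∑ j, (‖T 0 i j‖ + 1))
    (fun i _ => h1 i) (Finset.mem_univ i))

lemma exists_R_bound (hA : M.A.det ≠ 0) {β : ℝ}
    (hβ : ∀ z : ℂ, z.re ≤ β → (1 - z • M.Ac).det ≠ 0) :
    ∃ K : ℝ, 0 < K ∧ ∀ z : ℂ, z.re ≤ β → ∀ i j, ‖M.R z i j‖ ≤ K / (1 + ‖z‖) := by
  obtain ⟨δ, K, hδ, hK⟩ := exists_R_bound_of_large hA
  have hcomp : IsCompact (Metric.closedBall (0 : ℂ) δ⁻¹ ∩ {z | z.re ≤ β}) :=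
    (isCompact_closedBall _ _).inter_right (isClosed_le Complex.continuous_re continuous_const)
  have hbd : ∀ i j, ∃ C, ∀ z ∈ Metric.closedBall (0 : ℂ) δ⁻¹ ∩ {z | z.re ≤ β},
      ‖M.R z i j‖ ≤ C := fun i j =>
    hcomp.exists_bound_of_continuousOn fun z hz =>
      (differentiableAt_R (hβ z hz.2) i j).continuousAt.continuousWithinAt
  choose C hC using hbd
  set S := ∑ i, ∑ j, |C i j| with hS
  have hCS : ∀ i j, C i j ≤ S := fun i j => (le_abs_self _).trans
    ((Finset.single_le_sum (f := fun j => |C i j|) (fun j _ => abs_nonneg _)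
      (Finset.mem_univ j)).trans (Finset.single_le_sum (f := fun i => ∑ j, |C i j|)
      (fun i _ => by positivity) (Finset.mem_univ i)))
  have hS0 : 0 ≤ S := by positivity
  -- The first term serves the compact part `|z| ≤ δ⁻¹`, the second the rest, where `1 ≤ δ|z|`; the
  -- last makes the constant positive.
  refine ⟨S * (1 + δ⁻¹) + |K| * (δ + 1) + 1, by positivity, fun z hz i j => ?_⟩
  have hδ0 : 0 < δ⁻¹ := inv_pos.mpr hδ
  rw [le_div_iff₀ (by positivity)]
  have hnn := norm_nonneg (M.R z i j)
  rcases le_or_gt ‖z‖ δ⁻¹ with h | h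
  · have h1 : ‖M.R z i j‖ ≤ S :=
      (hC i j z ⟨mem_closedBall_zero_iff.mpr h, hz⟩).trans (hCS i j)
    have h2 : ‖M.R z i j‖ * (1 + ‖z‖) ≤ S * (1 + δ⁻¹) := by gcongr
    have : 0 ≤ |K| * (δ + 1) := by positivity
    linarith
  · have h1 : ‖z‖ * ‖M.R z i j‖ ≤ |K| := (hK z h i j).trans (le_abs_self K)
    have h2 : 1 ≤ δ * ‖z‖ := by
      have := mul_le_mul_of_nonneg_left h.le hδ.le
      rwa [mul_inv_cancel₀ hδ.ne'] at this
    have h3 : ‖M.R z i j‖ ≤ δ * (‖z‖ * ‖M.R z i j‖) := by nlinarith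
    have h4 : δ * (‖z‖ * ‖M.R z i j‖) ≤ δ * |K| := by gcongr
    have : 0 ≤ S * (1 + δ⁻¹) := by positivity
    nlinarith

/-- The resolvent identity, read in the last component of `R𝟙`. -/
lemma r_sub_r (hs : M.StifflyAccurate) {z w : ℂ} (hz : (1 - z • M.Ac).det ≠ 0)
    (hw : (1 - w • M.Ac).det ≠ 0) :
    M.r z - M.r w = (z - w) * ((M.R z * M.Ac * M.R w) *ᵥ 1) (Fin.last m) := by
  have h : M.R z - M.R w = (z - w) • (M.R z * M.Ac * M.R w) := by
    calc M.R z - M.R w = M.R z * ((1 - w • M.Ac) * M.R w) - M.R z * (1 - z • M.Ac) * M.R w := by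
          rw [one_sub_mul_R hw, R_mul_one_sub hz, mul_one, one_mul]
      _ = M.R z * ((1 - w • M.Ac) - (1 - z • M.Ac)) * M.R w := by
          generalize 1 - w • M.Ac = P, 1 - z • M.Ac = P'
          rw [mul_sub, sub_mul, mul_assoc (M.R z) P]
      _ = (z - w) • (M.R z * M.Ac * M.R w) := by
          rw [sub_sub_sub_cancel_left, ← sub_smul, mul_smul_comm, smul_mul_assoc]
  rw [r_eq_last hs hz, r_eq_last hs hw, ← Pi.sub_apply, ← Matrix.sub_mulVec, h,
    Matrix.smul_mulVec, Pi.smul_apply, smul_eq_mul]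

lemma norm_q_le {z : ℂ} {y : ℝ} (hy : ∀ i j, ‖M.R z i j‖ ≤ y) (j : Fin (m + 1)) :
    ‖M.q z j‖ ≤ (∑ i, ‖M.bc i‖) * y := by
  rw [q_eq, Matrix.vecMul, dotProduct, Finset.sum_mul]
  refine norm_sum_le_of_le _ fun i _ => ?_
  rw [norm_mul]
  exact mul_le_mul_of_nonneg_left (hy i j) (norm_nonneg _)

lemma norm_R_mulVec_one_le {z : ℂ} {y : ℝ} (hy : ∀ i j, ‖M.R z i j‖ ≤ y) (i : Fin (m + 1)) :
    ‖(M.R z *ᵥ 1) i‖ ≤ (m + 1) * y := by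
  simp only [Matrix.mulVec, dotProduct, Pi.one_apply, mul_one]
  refine (norm_sum_le_of_le _ fun j _ => hy i j).trans (le_of_eq ?_)
  simp

lemma norm_Ac_mul_R_le {z : ℂ} {y : ℝ} (hy : ∀ i j, ‖M.R z i j‖ ≤ y) (i j : Fin (m + 1)) :
    ‖(M.Ac * M.R z) i j‖ ≤ (∑ i, ∑ k, ‖M.Ac i k‖) * y := by
  have hy0 : 0 ≤ y := (norm_nonneg _).trans (hy 0 0)
  rw [Matrix.mul_apply]
  have h1 : ‖∑ k, M.Ac i k * M.R z k j‖ ≤ (∑ k, ‖M.Ac i k‖) * y := by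
    rw [Finset.sum_mul]
    refine norm_sum_le_of_le _ fun k _ => ?_
    rw [norm_mul]
    exact mul_le_mul_of_nonneg_left (hy k j) (norm_nonneg _)
  refine h1.trans (mul_le_mul_of_nonneg_right ?_ hy0)
  exact Finset.single_le_sum (f := fun i => ∑ k, ‖M.Ac i k‖)
    (fun i _ => by positivity) (Finset.mem_univ i)

/-- Comparing `z` with `w = i Im z`, where `|r(w)| ≤ 1`, gives `|r(z)| ≤ 1 + C Re z ≤ e^((C+2) Re
z)`. The 2 guarantees `γ > 1`. -/
theorem exists_isStabilityBound (hA : M.A.det ≠ 0) (hst : M.AStable) (hs : M.StifflyAccurate)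
    (N : Seminorm ℂ (Fin (m + 1) → ℂ)) : ∃ γ β Cq : ℝ, M.IsStabilityBound N γ β Cq := by
  obtain ⟨β, hβ0, hβ⟩ := exists_det_ne_zero hst
  obtain ⟨K, hK0, hK⟩ := exists_R_bound hA hβ
  obtain ⟨D, hD1, hD⟩ := exists_seminorm_pi_le N
  have hy : ∀ z : ℂ, z.re ≤ β → ∀ i j, ‖M.R z i j‖ ≤ K := fun z hz i j =>
    (hK z hz i j).trans (div_le_self hK0.le (by linarith [norm_nonneg z]))
  set a := ∑ i, ∑ k, ‖M.Ac i k‖ with ha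
  have ha0 : 0 ≤ a := by positivity
  set C := (m + 1) * ((m + 1) * (K * (a * K))) with hC
  have hC0 : 0 ≤ C := by positivity
  refine ⟨C + 2, β, D * ((∑ i, ‖M.bc i‖) * K) + 1, by linarith, hβ0, by positivity,
    fun z h0 h1 => ?_, fun z hz => ?_⟩
  · set w : ℂ := (z.im : ℂ) * Complex.I with hw
    have hwre : w.re = 0 := by simp [hw]
    have hzw : ‖z - w‖ = z.re := by
      have : z - w = (z.re : ℂ) := by
        rw [hw, sub_eq_iff_eq_add]; exact (Complex.re_add_im z).symm
      rw [this, Complex.norm_real, Real.norm_of_nonneg h0]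
    have hwβ : w.re ≤ β := by rw [hwre]; exact hβ0.le
    have hd := r_sub_r hs (hβ z h1) (hβ w hwβ)
    have hent : ∀ i j, ‖(M.R z * M.Ac * M.R w) i j‖ ≤ (m + 1) * (K * (a * K)) := by
      intro i j
      rw [mul_assoc, Matrix.mul_apply]
      refine (norm_sum_le_of_le (n := fun _ => K * (a * K)) _ fun k _ => ?_).trans
        (le_of_eq (by simp))
      rw [norm_mul]
      exact mul_le_mul (hy z h1 i k) (norm_Ac_mul_R_le (hy w hwβ) k j) (norm_nonneg _) hK0.le
    have hlast : ‖((M.R z * M.Ac * M.R w) *ᵥ 1) (Fin.last m)‖ ≤ C := by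
      simp only [Matrix.mulVec, dotProduct, Pi.one_apply, mul_one]
      refine (norm_sum_le_of_le _ fun j _ => hent _ j).trans (le_of_eq ?_)
      simp [hC]
    have h2 : ‖M.r z - M.r w‖ ≤ z.re * C := by
      rw [hd, norm_mul, hzw]
      gcongr
    have h3 : ‖M.r z‖ ≤ 1 + z.re * C := by
      have h4 := norm_add_le (M.r w) (M.r z - M.r w)
      rw [add_sub_cancel] at h4
      linarith [(hst w hwre.le).2]
    have h5 := Real.add_one_le_exp ((C + 2) * z.re)
    nlinarith
  · have := hD (M.q z) ((∑ i, ‖M.bc i‖) * K) (by positivity) (norm_q_le (hy z hz))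
    linarith

/-- One quantity `Y = κK / (1 + |Re z|)` dominates `r` and the entries of `q`, `R𝟙` and `A R`, so
the entries of `eₙ` and `Eₙ` are at most `Y^(n+1)`. -/
theorem exists_isDecayBound (hA : M.A.det ≠ 0) (hst : M.AStable) (hs : M.StifflyAccurate)
    (N : Seminorm ℂ (Fin (m + 1) → ℂ)) (N' : Seminorm ℂ (Matrix (Fin (m + 1)) (Fin (m + 1)) ℂ)) :
    ∃ c x₀ : ℝ, M.IsDecayBound N N' c x₀ := by
  obtain ⟨K, hK0, hK⟩ := exists_R_bound (β := 0) hA fun z hz => (hst z hz).1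
  obtain ⟨D₁, hD₁1, hD₁⟩ := exists_seminorm_pi_le N
  obtain ⟨D₂, hD₂1, hD₂⟩ := exists_seminorm_matrix_le N'
  set D := max D₁ D₂ with hDdef
  have hD1 : 1 ≤ D := hD₁1.trans (le_max_left _ _)
  set a := ∑ i, ∑ k, ‖M.Ac i k‖ with ha
  set b := ∑ i, ‖M.bc i‖ with hb
  set κ := (m + 1) + a + b with hκ
  have ha0 : 0 ≤ a := by positivity
  have hb0 : 0 ≤ b := by positivity
  have hm0 : (0 : ℝ) ≤ m := Nat.cast_nonneg m
  have hκ1 : 1 ≤ κ := by linarith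
  set H := D * (κ * K) with hH
  have hH0 : 0 < H := by positivity
  -- Chosen so that `x₀ - c Re z = (1 + |Re z|) / H = 1 / (D Y)`.
  refine ⟨H⁻¹, H⁻¹, inv_pos.mpr hH0, inv_pos.mpr hH0, fun n z hz => ?_⟩
  have hdet := (hst z hz.le).1
  set x := -z.re with hx
  have hx0 : 0 < x := by linarith
  set y := K / (1 + x) with hy
  have hy0 : 0 ≤ y := by positivity
  have hRy : ∀ i j, ‖M.R z i j‖ ≤ y := fun i j => by
    refine (hK z hz.le i j).trans ?_
    have : x ≤ ‖z‖ := (neg_le_abs z.re).trans (Complex.abs_re_le_norm z)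
    rw [hy]
    gcongr
  set Y := κ * y with hY
  have hY0 : 0 ≤ Y := by positivity
  have hq : ∀ j, ‖M.q z j‖ ≤ Y := fun j => (norm_q_le hRy j).trans (by
    rw [hY]; gcongr; linarith)
  have hR1 : ∀ i, ‖(M.R z *ᵥ 1) i‖ ≤ Y := fun i => (norm_R_mulVec_one_le hRy i).trans (by
    rw [hY]; gcongr; linarith)
  have hAR : ∀ i j, ‖(M.Ac * M.R z) i j‖ ≤ Y := fun i j => (norm_Ac_mul_R_le hRy i j).trans (by
    rw [hY]; gcongr; linarith)
  have hr : ‖M.r z‖ ≤ Y := by rw [r_eq_last hs hdet]; exact hR1 _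
  have he : ∀ j, ‖M.e n z j‖ ≤ Y ^ (n + 1) := fun j => by
    rw [e_eq hA hs hdet, Pi.smul_apply, smul_eq_mul, norm_mul, norm_pow, pow_succ]
    exact mul_le_mul (pow_le_pow_left₀ (norm_nonneg _) hr n) (hq j) (norm_nonneg _) (by positivity)
  have hE : ∀ i j, ‖M.E n z i j‖ ≤ Y ^ (n + 1) := fun i j => by
    cases n with
    | zero => rw [E_zero hA hdet, zero_add, pow_one]; exact hAR i j
    | succ n =>
      rw [E_succ hA hdet, Matrix.smul_apply, Matrix.vecMulVec_apply, smul_eq_mul, norm_mul,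
        norm_mul, norm_pow, pow_succ, pow_succ, mul_assoc]
      exact mul_le_mul (pow_le_pow_left₀ (norm_nonneg _) hr n)
        (mul_le_mul (hR1 i) (hq j) (norm_nonneg _) hY0) (by positivity) (by positivity)
  have hrhs : |H⁻¹ - H⁻¹ * z.re| ^ (-(n : ℤ) - 1) = (D * Y) ^ (n + 1) := by
    have e1 : H⁻¹ - H⁻¹ * z.re = (D * Y)⁻¹ := by
      rw [hY, hy, hH]
      have : z.re = -x := by rw [hx]; ring
      rw [this]
      have hDp : D ≠ 0 := by positivity
      have hκp : κ ≠ 0 := by positivity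
      field_simp
      ring
    have e2 : (-(n : ℤ) - 1) = -((n + 1 : ℕ) : ℤ) := by push_cast; ring
    rw [e1, abs_of_nonneg (by positivity), e2, zpow_neg, zpow_natCast, inv_pow, inv_inv]
  have hfin : D * Y ^ (n + 1) ≤ (D * Y) ^ (n + 1) := by
    rw [mul_pow D Y]
    have : D ≤ D ^ (n + 1) := le_self_pow₀ hD1 (Nat.succ_ne_zero n)
    exact mul_le_mul_of_nonneg_right this (pow_nonneg hY0 _)
  rw [hrhs]
  have hYn : 0 ≤ Y ^ (n + 1) := by positivity
  refine max_le ?_ ?_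
  · exact ((hD₁ _ _ hYn he).trans (mul_le_mul_of_nonneg_right (le_max_left _ _) hYn)).trans hfin
  · exact ((hD₂ _ _ hYn hE).trans (mul_le_mul_of_nonneg_right (le_max_right _ _) hYn)).trans hfin

end RungeKutta

/-! ### The optimal parameter of the error bound -/

lemma g_eq {ε B : ℝ} (hB : 0 < B) (hε : ε ≤ 1) :
    1 ≤ g ε B ∧ (g ε B + (g ε B)⁻¹) / 2 = 1 + 2 / B * (1 - ε) := by
  have hp : 1 ≤ 1 + 2 / B * (1 - ε) := by
    have : 0 ≤ 2 / B * (1 - ε) := mul_nonneg (by positivity) (by linarith)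
    linarith
  unfold g
  set p := 1 + 2 / B * (1 - ε)
  have h0 : 0 ≤ p ^ 2 - 1 := by nlinarith
  have hs := Real.sqrt_nonneg (p ^ 2 - 1)
  refine ⟨by linarith, ?_⟩
  have hinv : (p + Real.sqrt (p ^ 2 - 1))⁻¹ = p - Real.sqrt (p ^ 2 - 1) :=
    inv_eq_of_mul_eq_one_right (by linear_combination -Real.sq_sqrt h0)
  rw [hinv]
  ring

lemma one_lt_g {ε B : ℝ} (hB : 0 < B) (hε : ε < 1) : 1 < g ε B := by
  have h := (g_eq hB hε.le).2
  have h1 := (g_eq hB hε.le).1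
  refine lt_of_le_of_ne h1 fun h2 => ?_
  rw [← h2] at h
  have : 0 < 2 / B * (1 - ε) := mul_pos (by positivity) (by linarith)
  norm_num at h
  rcases h with h | h
  · exact hB.ne' h
  · linarith

lemma continuous_g (B : ℝ) : Continuous fun ε => g ε B := by
  unfold g
  fun_prop

lemma g_one (B : ℝ) : g 1 B = 1 := by simp [g]

/-- In the variable `τ = √(1 - ε)` the square-root growth of `g` at `ε = 1` becomes linear. -/
lemma one_add_sqrt_mul_le_g {B τ : ℝ} (hB : 0 < B) (hτ : 0 ≤ τ) :
    1 + Real.sqrt (4 / B) * τ ≤ g (1 - τ ^ 2) B := by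
  have hd : 0 ≤ 2 / B * τ ^ 2 := by positivity
  have h1 : Real.sqrt (4 / B) * τ = Real.sqrt (4 / B * τ ^ 2) := by
    rw [Real.sqrt_mul (by positivity), Real.sqrt_sq hτ]
  have h2 : Real.sqrt (4 / B * τ ^ 2) ≤ Real.sqrt ((1 + 2 / B * τ ^ 2) ^ 2 - 1) := by
    apply Real.sqrt_le_sqrt
    have : 4 / B * τ ^ 2 = 2 * (2 / B * τ ^ 2) := by ring
    rw [this]
    nlinarith
  rw [g, sub_sub_cancel, h1]
  linarith

/-- By Bernoulli the product is at least `1 + τ (κ - nτ - κnτ²)`: a linear gain beats a quadratic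
loss. -/
lemma exists_one_lt_one_add_mul {κ : ℝ} (hκ : 0 < κ) (n : ℕ) :
    ∃ τ : ℝ, 0 < τ ∧ τ < 1 ∧ 1 < (1 + κ * τ) * (1 - τ ^ 2) ^ n := by
  have hc : ContinuousAt (fun τ : ℝ => κ - n * τ - κ * n * τ ^ 2) 0 := by fun_prop
  have hev : ∀ᶠ τ : ℝ in nhdsWithin 0 (Set.Ioi 0), 0 < κ - n * τ - κ * n * τ ^ 2 ∧ τ < 1 :=
    Filter.Eventually.filter_mono nhdsWithin_le_nhds
      ((hc.eventually_const_lt (by simpa using hκ)).and (eventually_lt_nhds one_pos))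
  obtain ⟨τ, ⟨h1, h2⟩, h3⟩ := (hev.and self_mem_nhdsWithin).exists
  have hτ : 0 < τ := h3
  refine ⟨τ, hτ, h2, ?_⟩
  have hb := one_add_mul_le_pow (a := -τ ^ 2) (by nlinarith) n
  rw [← sub_eq_add_neg] at hb
  have h4 : (1 + κ * τ) * (1 + n * (-τ ^ 2)) ≤ (1 + κ * τ) * (1 - τ ^ 2) ^ n :=
    mul_le_mul_of_nonneg_left hb (by positivity)
  nlinarith [mul_pos hτ h1]

/-- The reciprocal of `boundFun` on `(0, 1)`, extended continuously. -/
noncomputable def invBound (α h B ℓ Cq c x₀ : ℝ) (n Q : ℕ) (ε : ℝ) : ℝ :=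
  g ε B ^ (2 * Q) * ε ^ α * max Cq⁻¹ ((x₀ + c * ℓ * h * ε) ^ (n + 1))

section Bound

variable {α h B ℓ Cq c x₀ : ℝ} {n Q : ℕ}

lemma continuous_invBound (hα : 0 < α) : Continuous (invBound α h B ℓ Cq c x₀ n Q) := by
  have h1 := continuous_g B
  have h2 : Continuous fun ε : ℝ => ε ^ α := Real.continuous_rpow_const hα.le
  unfold invBound
  fun_prop

lemma abs_zpow_eq {y : ℝ} (hy : 0 < y) (n : ℕ) : |y| ^ (-(n : ℤ) - 1) = (y ^ (n + 1))⁻¹ := by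
  have e : (-(n : ℤ) - 1) = -((n + 1 : ℕ) : ℤ) := by push_cast; ring
  rw [abs_of_pos hy, e, zpow_neg, zpow_natCast]

lemma g_zpow_div {ε : ℝ} (hg : 0 < g ε B) (Q : ℕ) :
    g ε B ^ (-2 * (Q : ℤ) + 1) / g ε B = (g ε B)⁻¹ ^ (2 * Q) := by
  rw [zpow_add_one₀ hg.ne', mul_div_assoc, div_self hg.ne', mul_one, inv_pow, ← zpow_natCast,
    ← zpow_neg]
  congr 1

lemma boundFun_eq_inv (hB : 0 < B) (hC : 0 < Cq) (hk : 0 < c * ℓ * h) (hx : 0 < x₀) {ε : ℝ}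
    (hε : ε ∈ Set.Ioo (0 : ℝ) 1) :
    boundFun α h B ℓ Cq c x₀ n Q ε = (invBound α h B ℓ Cq c x₀ n Q ε)⁻¹ := by
  have hg : 0 < g ε B := by linarith [(g_eq hB hε.2.le).1]
  have hy : 0 < x₀ + c * ℓ * h * ε := add_pos hx (mul_pos hk hε.1)
  have hmin : min Cq (((x₀ + c * ℓ * h * ε) ^ (n + 1))⁻¹)
      = (max Cq⁻¹ ((x₀ + c * ℓ * h * ε) ^ (n + 1)))⁻¹ := by
    have hp : 0 < (x₀ + c * ℓ * h * ε) ^ (n + 1) := by positivity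
    rcases le_total Cq⁻¹ ((x₀ + c * ℓ * h * ε) ^ (n + 1)) with hle | hle
    · rw [max_eq_right hle, min_eq_right (inv_le_of_inv_le₀ hC hle)]
    · rw [max_eq_left hle, inv_inv, min_eq_left (le_inv_of_le_inv₀ hp hle)]
  rw [boundFun, invBound, g_zpow_div hg, abs_zpow_eq hy, hmin, mul_inv, mul_inv,
    Real.rpow_neg hε.1.le, inv_pow]

lemma exists_invBound_one_lt (hα : α < 1) (hB : 0 < B) (hC : 0 < Cq) (hk : 0 < c * ℓ * h)
    (hx : 0 < x₀) (hQ : 1 ≤ Q) :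
    ∃ ε ∈ Set.Ioo (0 : ℝ) 1,
      invBound α h B ℓ Cq c x₀ n Q 1 < invBound α h B ℓ Cq c x₀ n Q ε := by
  obtain ⟨τ, hτ0, hτ1, hτ⟩ := exists_one_lt_one_add_mul
    -- Of the exponent `n + 2`, one power pays for `ε^α ≥ ε` and `n + 1` for the decay factor.
    (κ := Real.sqrt (4 / B)) (Real.sqrt_pos.mpr (by positivity)) (n + 2)
  have hε0 : 0 < 1 - τ ^ 2 := by nlinarith
  have hε1 : 1 - τ ^ 2 < 1 := by nlinarith
  set ε := 1 - τ ^ 2 with hε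
  refine ⟨ε, ⟨hε0, hε1⟩, ?_⟩
  set k := c * ℓ * h with hkdef
  set μ := max Cq⁻¹ ((x₀ + k * 1) ^ (n + 1)) with hμ
  have hμ0 : 0 < μ := lt_max_of_lt_left (inv_pos.mpr hC)
  have h1 : invBound α h B ℓ Cq c x₀ n Q 1 = μ := by
    rw [invBound, g_one, one_pow, Real.one_rpow, one_mul, one_mul]
  have hgε := (g_eq hB hε1.le).1
  have h2 : 1 + Real.sqrt (4 / B) * τ ≤ g ε B ^ (2 * Q) :=
    (one_add_sqrt_mul_le_g hB hτ0.le).trans (le_self_pow₀ hgε (by omega))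
  have h3 : ε ≤ ε ^ α := by
    have := Real.rpow_le_rpow_of_exponent_ge hε0 hε1.le hα.le
    rwa [Real.rpow_one] at this
  have h4 : ε ^ (n + 1) * μ ≤ max Cq⁻¹ ((x₀ + k * ε) ^ (n + 1)) := by
    rw [hμ, mul_max_of_nonneg _ _ (by positivity)]
    refine max_le_max ?_ ?_
    · exact mul_le_of_le_one_left (inv_pos.mpr hC).le (pow_le_one₀ hε0.le hε1.le)
    · rw [← mul_pow]
      have : ε * (x₀ + k * 1) ≤ x₀ + k * ε := by nlinarith
      have h0 : 0 ≤ ε * (x₀ + k * 1) := by positivity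
      gcongr
  rw [h1]
  calc μ = 1 * μ := (one_mul μ).symm
    _ < (1 + Real.sqrt (4 / B) * τ) * ε ^ (n + 2) * μ := by gcongr
    _ = (1 + Real.sqrt (4 / B) * τ) * ε * (ε ^ (n + 1) * μ) := by ring
    _ ≤ g ε B ^ (2 * Q) * ε ^ α * max Cq⁻¹ ((x₀ + k * ε) ^ (n + 1)) := by gcongr
    _ = invBound α h B ℓ Cq c x₀ n Q ε := rfl

/-- A maximizer of `invBound` on `[0, 1]` cannot be 0, where the function vanishes, nor 1, by
`exists_invBound_one_lt`. -/
lemma exists_isLeast_boundFun (hα0 : 0 < α) (hα1 : α < 1) (hB : 0 < B) (hC : 0 < Cq)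
    (hk : 0 < c * ℓ * h) (hx : 0 < x₀) (hQ : 1 ≤ Q) :
    ∃ ε ∈ Set.Ioo (0 : ℝ) 1,
      IsLeast (boundFun α h B ℓ Cq c x₀ n Q '' Set.Ioo 0 1) (boundFun α h B ℓ Cq c x₀ n Q ε) := by
  obtain ⟨ε, hε, hmax⟩ := isCompact_Icc.exists_isMaxOn (Set.nonempty_Icc.mpr zero_le_one)
    (continuous_invBound (h := h) (B := B) (ℓ := ℓ) (Cq := Cq) (c := c) (x₀ := x₀) (n := n)
      (Q := Q) hα0).continuousOn
  obtain ⟨ε', hε', hlt⟩ := exists_invBound_one_lt (n := n) hα1 hB hC hk hx hQ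
  have h1 : invBound α h B ℓ Cq c x₀ n Q ε' ≤ invBound α h B ℓ Cq c x₀ n Q ε :=
    hmax (Set.Ioo_subset_Icc_self hε')
  have hpos : ∀ t ∈ Set.Ioo (0 : ℝ) 1, 0 < invBound α h B ℓ Cq c x₀ n Q t := fun t ht => by
    have h2 : 0 < g t B := by linarith [(g_eq hB ht.2.le).1]
    have h3 : 0 < t ^ α := Real.rpow_pos_of_pos ht.1 α
    have h4 : 0 < max Cq⁻¹ ((x₀ + c * ℓ * h * t) ^ (n + 1)) :=
      lt_max_of_lt_left (inv_pos.mpr hC)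
    unfold invBound
    positivity
  have h0 : invBound α h B ℓ Cq c x₀ n Q 0 = 0 := by
    rw [invBound, Real.zero_rpow hα0.ne', mul_zero, zero_mul]
  have hεI : ε ∈ Set.Ioo (0 : ℝ) 1 := by
    refine ⟨lt_of_le_of_ne hε.1 fun h => ?_, lt_of_le_of_ne hε.2 fun h => ?_⟩
    · have := hpos ε' hε'
      rw [← h, h0] at h1
      linarith
    · rw [h] at h1
      linarith
  refine ⟨ε, hεI, ⟨ε, hεI, rfl⟩, ?_⟩
  rintro _ ⟨t, ht, rfl⟩
  rw [boundFun_eq_inv hB hC hk hx hεI, boundFun_eq_inv hB hC hk hx ht]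
  exact inv_anti₀ (hpos t ht) (hmax (Set.Ioo_subset_Icc_self ht))

end Bound

/-! ### The quadrature error for the convolution weights -/

/-- The norming functional of a vector with respect to a seminorm. -/
lemma exists_functional_eq_seminorm {ι : Type*} [Finite ι] (N : Seminorm ℂ (ι → ℂ)) (v : ι → ℂ) :
    ∃ φ : (ι → ℂ) →L[ℂ] ℂ, (∀ w, ‖φ w‖ ≤ N w) ∧ φ v = N v := by
  have := Fintype.ofFinite ι
  rcases eq_or_ne v 0 with rfl | hv
  · exact ⟨0, fun w => by simp, by simp⟩
  · obtain ⟨ψ, hψ, hle⟩ := Module.Dual.exists_extension_of_le_seminorm (Submodule.span ℂ {v})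
      ((N v : ℂ) • (LinearEquiv.coord ℂ (ι → ℂ) v hv).toLinearMap) (p := N) (by
        intro x
        have hx : N x = ‖LinearEquiv.coord ℂ (ι → ℂ) v hv x‖ * N v := by
          conv_lhs => rw [← LinearEquiv.coord_apply_smul ℂ (ι → ℂ) v hv x]
          rw [map_smul_eq_mul]
        rw [LinearMap.smul_apply, norm_smul, Complex.norm_real,
          Real.norm_of_nonneg (apply_nonneg N v), hx, mul_comm]
        rfl)
    refine ⟨LinearMap.toContinuousLinearMap ψ, hle, ?_⟩
    have h := hψ ⟨v, Submodule.mem_span_singleton_self v⟩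
    have h1 : LinearEquiv.coord ℂ (ι → ℂ) v hv ⟨v, Submodule.mem_span_singleton_self v⟩ = 1 :=
      LinearEquiv.coord_self ℂ (ι → ℂ) v hv
    rw [LinearMap.smul_apply, LinearEquiv.coe_coe, h1, smul_eq_mul, mul_one] at h
    exact h

section GaussErrorAffine

variable {E F : Type*} [NormedAddCommGroup E] [NormedSpace ℝ E]
  [NormedAddCommGroup F] [NormedSpace ℝ F]

lemma gaussError_eq_smul (Q : ℕ) (a b : ℝ) (f : ℝ → E) :
    gaussError Q a b f
      = ((b - a) / 2) • gaussError Q (-1) 1 (fun y => f (a + (b - a) / 2 * (y + 1))) := by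
  rw [gaussError, gaussError, gaussRule_neg_one_one, gaussRule, smul_sub]
  congr 1
  have h := intervalIntegral.smul_integral_comp_mul_add (a := (-1 : ℝ)) (b := 1) f ((b - a) / 2)
    (a + (b - a) / 2)
  have e1 : (b - a) / 2 * -1 + (a + (b - a) / 2) = a := by ring
  have e2 : (b - a) / 2 * 1 + (a + (b - a) / 2) = b := by ring
  rw [e1, e2] at h
  rw [← h]
  congr 2
  funext y
  congr 1
  ring

lemma map_gaussError [CompleteSpace E] [CompleteSpace F] (L : E →L[ℝ] F) {Q : ℕ} {a b : ℝ}
    {f : ℝ → E} (hf : IntervalIntegrable f MeasureTheory.volume a b) :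
    L (gaussError Q a b f) = gaussError Q a b (fun x => L (f x)) := by
  simp only [gaussError, gaussRule, map_sub, map_smul, map_sum]
  rw [L.intervalIntegral_comp_comm hf]

end GaussErrorAffine

/-- `t + t⁻¹` is largest on `[ρ⁻¹, ρ]` at the end points, so the left vertex of the ellipse is its
leftmost point. -/
lemma neg_le_re_joukowski {ρ : ℝ} (hρ : 1 < ρ) {u : ℂ} (h1 : ρ⁻¹ ≤ ‖u‖) (h2 : ‖u‖ ≤ ρ) :
    -((ρ + ρ⁻¹) / 2) ≤ ((u + u⁻¹) / 2).re := by
  have hρ0 : 0 < ρ := by linarith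
  have ht : 0 < ‖u‖ := (inv_pos.mpr hρ0).trans_le h1
  have h3 : ‖(u + u⁻¹) / 2‖ ≤ (‖u‖ + ‖u‖⁻¹) / 2 := by
    rw [norm_div, Complex.norm_ofNat, ← norm_inv]
    gcongr
    exact norm_add_le _ _
  have h4 : ‖u‖ + ‖u‖⁻¹ ≤ ρ + ρ⁻¹ := by
    have h5 : 1 ≤ ρ * ‖u‖ := by
      have := mul_le_mul_of_nonneg_left h1 hρ0.le
      rwa [mul_inv_cancel₀ hρ0.ne'] at this
    have h6 : ρ + ρ⁻¹ - (‖u‖ + ‖u‖⁻¹) = (ρ - ‖u‖) * (ρ * ‖u‖ - 1) / (ρ * ‖u‖) := by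
      field_simp
      ring
    have h7 : 0 ≤ (ρ - ‖u‖) * (ρ * ‖u‖ - 1) / (ρ * ‖u‖) :=
      div_nonneg (mul_nonneg (by linarith) (by linarith)) (by positivity)
    linarith
  have := (abs_le.mp ((Complex.abs_re_le_norm _).trans h3)).1
  linarith

namespace RungeKutta

variable {m : ℕ} {M : RungeKutta m}

/-- The analytic continuation to the right half-plane of a linear functional of the integrand. -/
noncomputable def extIntegrand (M : RungeKutta m) (φ : (Fin (m + 1) → ℂ) →L[ℂ] ℂ) (α h : ℝ) (n : ℕ)
    (w : ℂ) : ℂ :=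
  ((h * Real.sin (Real.pi * α) / Real.pi : ℝ) : ℂ) * w ^ ((-α : ℝ) : ℂ)
    * (M.r (-(h * w)) ^ n * φ (M.q (-(h * w))))

variable {φ : (Fin (m + 1) → ℂ) →L[ℂ] ℂ} {α h : ℝ} {n : ℕ}

lemma neg_mul_re_neg (hh : 0 < h) {w : ℂ} (hw : 0 < w.re) : (-((h : ℂ) * w)).re < 0 := by
  rw [Complex.neg_re, Complex.re_ofReal_mul]
  exact neg_lt_zero.mpr (mul_pos hh hw)

lemma differentiableAt_extIntegrand (hst : M.AStable) (hh : 0 < h) {w : ℂ} (hw : 0 < w.re) :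
    DifferentiableAt ℂ (M.extIntegrand φ α h n) w := by
  have hdet := (hst _ (neg_mul_re_neg hh hw).le).1
  have hlin : DifferentiableAt ℂ (fun w : ℂ => -((h : ℂ) * w)) w := by fun_prop
  have hr : DifferentiableAt ℂ (fun w : ℂ => M.r (-(h * w))) w :=
    DifferentiableAt.comp (g := M.r) w (differentiableAt_r hdet) hlin
  have hq : DifferentiableAt ℂ (fun w : ℂ => M.q (-(h * w))) w :=
    DifferentiableAt.comp (g := M.q) w (differentiableAt_pi.mpr fun j => differentiableAt_q hdet j) hlin
  have hφ : DifferentiableAt ℂ (fun w : ℂ => φ (M.q (-(h * w)))) w :=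
    DifferentiableAt.comp w φ.differentiableAt hq
  have hpow : DifferentiableAt ℂ (fun w : ℂ => w ^ ((-α : ℝ) : ℂ)) w :=
    differentiableAt_id.cpow_const (Or.inl hw)
  exact (hpow.const_mul _).mul ((hr.pow n).mul hφ)

lemma map_integrand (hA : M.A.det ≠ 0) (hst : M.AStable) (hs : M.StifflyAccurate) (hh : 0 < h)
    {x : ℝ} (hx : 0 < x) : φ (M.integrand α h n x) = M.extIntegrand φ α h n x := by
  have hz : (-((h * x : ℝ) : ℂ)).re ≤ 0 := by
    rw [Complex.neg_re, Complex.ofReal_re]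
    nlinarith
  rw [integrand, e_eq hA hs (hst _ hz).1, φ.map_smul_of_tower, map_smul, extIntegrand,
    Complex.real_smul, smul_eq_mul, ← Complex.ofReal_cpow hx.le]
  push_cast
  ring

lemma continuousOn_integrand (hA : M.A.det ≠ 0) (hst : M.AStable) (hs : M.StifflyAccurate)
    (hh : 0 < h) : ContinuousOn (M.integrand α h n) (Set.Ioi 0) := by
  refine continuousOn_pi.mpr fun j => ?_
  have h1 : ∀ x ∈ Set.Ioi (0 : ℝ), M.integrand α h n x j
      = M.extIntegrand (ContinuousLinearMap.proj j) α h n x := fun x hx =>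
    map_integrand (φ := ContinuousLinearMap.proj j) hA hst hs hh hx
  refine ContinuousOn.congr (fun x hx => ?_) h1
  exact (ContinuousAt.comp (f := fun x : ℝ => (x : ℂ))
    (differentiableAt_extIntegrand hst hh (w := x) (by simpa using hx)).continuousAt
    Complex.continuous_ofReal.continuousAt).continuousWithinAt

/-- Two estimates of `rⁿ q`: `|r| ≤ 1` in the left half-plane with `q` bounded by `Cq`, and the
decay bound, monotone in `Re w`. -/
lemma norm_extIntegrand_le {N : Seminorm ℂ (Fin (m + 1) → ℂ)}
    {N' : Seminorm ℂ (Matrix (Fin (m + 1)) (Fin (m + 1)) ℂ)} {γ β Cq c x₀ : ℝ}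
    (hA : M.A.det ≠ 0) (hst : M.AStable) (hs : M.StifflyAccurate)
    (hS : M.IsStabilityBound N γ β Cq) (hD : M.IsDecayBound N N' c x₀)
    (hφ : ∀ v, ‖φ v‖ ≤ N v) (hα0 : 0 < α) (hα1 : α < 1) (hh : 0 < h) {d : ℝ} (hd : 0 < d) {w : ℂ}
    (hw : d ≤ w.re) :
    ‖M.extIntegrand φ α h n w‖ ≤ h * Real.sin (Real.pi * α) / Real.pi * d ^ (-α)
      * min Cq (|x₀ + c * h * d| ^ (-(n : ℤ) - 1)) := by
  obtain ⟨-, hβ, hC, -, hq⟩ := hS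
  obtain ⟨hc, hx, hdec⟩ := hD
  have hw0 : 0 < w.re := hd.trans_le hw
  set z : ℂ := -(h * w) with hz
  have hzre : z.re < 0 := neg_mul_re_neg hh hw0
  have hsin : 0 < Real.sin (Real.pi * α) :=
    Real.sin_pos_of_pos_of_lt_pi (by have := Real.pi_pos; positivity)
      (by nlinarith [Real.pi_pos])
  have hcoef : 0 ≤ h * Real.sin (Real.pi * α) / Real.pi := by
    have := Real.pi_pos
    positivity
  have hpow : ‖w ^ ((-α : ℝ) : ℂ)‖ ≤ d ^ (-α) := by
    rw [Complex.norm_cpow_real]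
    exact Real.rpow_le_rpow_of_nonpos hd (hw.trans (Complex.re_le_norm w)) (by linarith)
  obtain ⟨hdet, hr⟩ := hst z hzre.le
  have h1 : ‖M.r z ^ n * φ (M.q z)‖ ≤ Cq := by
    rw [norm_mul, norm_pow]
    calc ‖M.r z‖ ^ n * ‖φ (M.q z)‖ ≤ 1 * Cq := by
          gcongr
          · exact pow_le_one₀ (norm_nonneg _) hr
          · exact (hφ _).trans (hq z (by linarith))
      _ = Cq := one_mul _
  have h2 : ‖M.r z ^ n * φ (M.q z)‖ ≤ |x₀ + c * h * d| ^ (-(n : ℤ) - 1) := by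
    have h3 : M.r z ^ n * φ (M.q z) = φ (M.e n z) := by
      rw [e_eq hA hs hdet, map_smul, smul_eq_mul]
    have h4 : 0 < x₀ + c * h * d := by positivity
    have h5 : x₀ + c * h * d ≤ x₀ - c * z.re := by
      rw [hz, Complex.neg_re, Complex.re_ofReal_mul]
      have : c * h * d ≤ c * h * w.re := by gcongr
      linarith
    rw [h3]
    refine ((hφ _).trans ((le_max_left _ _).trans (hdec n z hzre))).trans ?_
    rw [abs_zpow_eq h4, abs_zpow_eq (h4.trans_le h5)]
    gcongr
  rw [extIntegrand, norm_mul, norm_mul, Complex.norm_real, Real.norm_of_nonneg hcoef]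
  gcongr
  exact le_min h1 h2

theorem seminorm_gaussError_integrand_le {N : Seminorm ℂ (Fin (m + 1) → ℂ)}
    {N' : Seminorm ℂ (Matrix (Fin (m + 1)) (Fin (m + 1)) ℂ)} {γ β Cq c x₀ B ℓ ε : ℝ} {Q : ℕ}
    (hA : M.A.det ≠ 0) (hst : M.AStable) (hs : M.StifflyAccurate)
    (hS : M.IsStabilityBound N γ β Cq) (hD : M.IsDecayBound N N' c x₀)
    (hα0 : 0 < α) (hα1 : α < 1) (hh : 0 < h) (hB : 0 < B) (hℓ : 0 < ℓ) (hQ : 1 ≤ Q)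
    (hε : ε ∈ Set.Ioo (0 : ℝ) 1) :
    N (gaussError Q ℓ ((B + 1) * ℓ) (M.integrand α h n)) ≤
      4 * h * B * ℓ ^ (1 - α) * Real.sin (Real.pi * α) / Real.pi
        * boundFun α h B ℓ Cq c x₀ n Q ε := by
  set τ := gaussError Q ℓ ((B + 1) * ℓ) (M.integrand α h n) with hτ
  obtain ⟨φ, hφ, hφτ⟩ := exists_functional_eq_seminorm N τ
  have hle : ℓ ≤ (B + 1) * ℓ := by nlinarith
  have hlen : ((B + 1) * ℓ - ℓ) / 2 = B * ℓ / 2 := by ring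
  have hint : IntervalIntegrable (M.integrand α h n) MeasureTheory.volume ℓ ((B + 1) * ℓ) :=
    ((continuousOn_integrand hA hst hs hh).mono fun x hx =>
      hℓ.trans_le hx.1).intervalIntegrable_of_Icc hle
  set ρ := g ε B with hρdef
  have hρ : 1 < ρ := one_lt_g hB hε.2
  have hρ0 : 0 < ρ := by linarith
  have hJ := (g_eq hB hε.2.le).2
  rw [← hρdef] at hJ
  set S := h * Real.sin (Real.pi * α) / Real.pi * (ε * ℓ) ^ (-α)
      * min Cq (|x₀ + c * h * (ε * ℓ)| ^ (-(n : ℤ) - 1)) with hSdef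
  -- The definition of `g` places the image of the left vertex exactly at `εℓ`.
  have hre : ∀ w : ℂ, -((ρ + ρ⁻¹) / 2) ≤ w.re →
      ε * ℓ ≤ (ℓ + ((B * ℓ / 2 : ℝ) : ℂ) * (w + 1)).re := by
    intro w hw
    rw [hJ] at hw
    simp only [Complex.add_re, Complex.ofReal_re, Complex.re_ofReal_mul, Complex.one_re]
    have h1 : B * ℓ / 2 * (-(1 + 2 / B * (1 - ε))) ≤ B * ℓ / 2 * w.re := by gcongr
    have h2 : B * ℓ / 2 * (-(1 + 2 / B * (1 - ε))) = -(B * ℓ / 2) - ℓ * (1 - ε) := by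
      field_simp
      ring
    linarith
  have hεℓ : 0 < ε * ℓ := mul_pos hε.1 hℓ
  have hell : BoundedOnEllipse
      (fun w => M.extIntegrand φ α h n (ℓ + ((B * ℓ / 2 : ℝ) : ℂ) * (w + 1))) ρ S := by
    intro u h1 h2
    have h3 := hre _ (neg_le_re_joukowski hρ h1 h2)
    refine ⟨?_, norm_extIntegrand_le hA hst hs hS hD hφ hα0 hα1 hh hεℓ h3⟩
    exact DifferentiableAt.comp
      (f := fun w : ℂ => (ℓ : ℂ) + ((B * ℓ / 2 : ℝ) : ℂ) * (w + 1)) _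
      (differentiableAt_extIntegrand hst hh (hεℓ.trans_le h3)) (by fun_prop)
  have hcong : ∀ y ∈ Set.Icc (-1 : ℝ) 1, φ (M.integrand α h n (ℓ + B * ℓ / 2 * (y + 1)))
      = M.extIntegrand φ α h n (ℓ + ((B * ℓ / 2 : ℝ) : ℂ) * ((y : ℂ) + 1)) := by
    intro y hy
    have hpos : 0 < ℓ + B * ℓ / 2 * (y + 1) :=
      add_pos_of_pos_of_nonneg hℓ (mul_nonneg (by positivity) (by linarith [hy.1]))
    rw [map_integrand hA hst hs hh hpos]
    push_cast
    rfl
  have hφE : φ τ = (B * ℓ / 2) • gaussError Q (-1) 1 (fun y : ℝ =>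
      M.extIntegrand φ α h n (ℓ + ((B * ℓ / 2 : ℝ) : ℂ) * ((y : ℂ) + 1))) := by
    have h1 := map_gaussError (φ.restrictScalars ℝ) (Q := Q) hint
    rw [← gaussError_congr hcong, ← hlen]
    exact h1.trans (gaussError_eq_smul _ _ _ _)
  have hN : N τ = ‖φ τ‖ := by
    rw [hφτ, Complex.norm_real, Real.norm_of_nonneg (apply_nonneg N τ)]
  have hmain := norm_gaussError_le hell hρ hQ
  -- The half-length turns 8 into 4, and its factor `ℓ` joins `(εℓ)^(-α)` to give `ℓ^(1-α) ε^(-α)`.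
  have hlast : B * ℓ / 2 * (8 * S * ρ⁻¹ ^ (2 * Q))
      = 4 * h * B * ℓ ^ (1 - α) * Real.sin (Real.pi * α) / Real.pi
        * boundFun α h B ℓ Cq c x₀ n Q ε := by
    have e1 : c * h * (ε * ℓ) = c * ℓ * h * ε := by ring
    rw [boundFun, g_zpow_div hρ0, hSdef, Real.mul_rpow hε.1.le hℓ.le, e1, sub_eq_add_neg 1 α,
      Real.rpow_add hℓ, Real.rpow_one]
    ring
  rw [hN, hφE, norm_smul, Real.norm_of_nonneg (by positivity), ← hlast]
  gcongr

end RungeKutta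

end CQ

theorem mainTheorem5 {m : ℕ} (M : CQ.RungeKutta m)
    (hA : M.A.det ≠ 0) (hstable : M.AStable) (hstiff : M.StifflyAccurate)
    (N : Seminorm ℂ (Fin (m + 1) → ℂ)) (hN : ∀ v, N v = 0 → v = 0)
    (N' : Seminorm ℂ (Matrix (Fin (m + 1)) (Fin (m + 1)) ℂ)) (hN' : ∀ V, N' V = 0 → V = 0) :
    (∃ γ β Cq : ℝ, M.IsStabilityBound N γ β Cq) ∧
    (∃ c x₀ : ℝ, M.IsDecayBound N N' c x₀) ∧
    ∀ γ β Cq c x₀ : ℝ, M.IsStabilityBound N γ β Cq → M.IsDecayBound N N' c x₀ →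
    ∀ α h B : ℝ, 0 < α → α < 1 → 0 < h → 0 < B →
    ∀ (J : ℕ) (L : ℕ → ℝ), 0 < L 0 →
      (∀ i, 1 ≤ i → i ≤ J → L i = (B + 1) * L (i - 1)) →
    ∀ n Q j : ℕ, 1 ≤ Q → 1 ≤ j → j ≤ J →
    ∃ μ : ℝ,
      IsLeast (CQ.boundFun α h B (L (j - 1)) Cq c x₀ n Q '' Set.Ioo 0 1) μ ∧
      N (CQ.gaussError Q (L (j - 1)) (L j) (M.integrand α h n)) ≤
        4 * h * B * L (j - 1) ^ (1 - α) * Real.sin (Real.pi * α) / Real.pi * μ := by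
  refine ⟨CQ.RungeKutta.exists_isStabilityBound hA hstable hstiff N,
    CQ.RungeKutta.exists_isDecayBound hA hstable hstiff N N', ?_⟩
  intro γ β Cq c x₀ hS hD α h B hα0 hα1 hh hB J L hL0 hL n Q j hQ hj hjJ
  have hpos : ∀ i, i ≤ J → 0 < L i := by
    intro i
    induction i with
    | zero => exact fun _ => hL0
    | succ i ih =>
      intro hi
      rw [hL (i + 1) (by omega) hi, Nat.add_sub_cancel]
      exact mul_pos (by linarith) (ih (by omega))
  have hℓ := hpos (j - 1) (by omega)
  obtain ⟨ε, hε, hleast⟩ := CQ.exists_isLeast_boundFun (n := n) hα0 hα1 hB hS.2.2.1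
    (mul_pos (mul_pos hD.1 hℓ) hh) hD.2.1 hQ
  refine ⟨_, hleast, ?_⟩
  rw [hL j hj hjJ]
  exact CQ.RungeKutta.seminorm_gaussError_integrand_le hA hstable hstiff hS hD hα0 hα1 hh hB hℓ hQ hε
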